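/- **Setting.** A *logical system* $\mathcal S=(\mathcal L,\mathcal M)$ consists of a set $\mathcal L$ of sentences and a set $\mathcal M$ of interpretations, each of which makes every knowledge-base $L\subseteq\mathcal L$ true or false; $\mathcal M_L$ is the set of models of $L$, and $L\vDash_{\mathcal S}L'$ means $\mathcal M_L\subseteq\mathcal M_{L'}$. For a network $N:X\to X$ on a metric state space, $X_{\inf}$ is the set of all limits $\lim_k N^{t_k}(x_0)$ with $x_0\in X$ and $t_1<t_2<\dots$; $N$ is *stable* if $d(N^t(x),X_{\inf})\to0$ for all $x\in X$. Let $i:X\to2^{\mathcal M}$ depend only on the visible units and let $Agg:2^{2^{\mathcal M}}\to2^{\mathcal M}$; put $\mathcal M_N=Agg(\{i(x):x\in X_{\inf}\})$. Then $N$ is a *semantic encoding* of $L$ under $i$ and $Agg$ if $\emptyset\neq\mathcal M_N\subseteq\mathcal M_L$ and, for every $L'\subseteq\mathcal L$, $L\vDash_{\mathcal S}L'$ iff $\mathcal M_N\subseteq\mathcal M_{L'}$. **Logic.** Let $\Sigma$ be a finite nonempty alphabet. The formulas of first-order logic with majority quantifiers, $\mathrm{FO}(\mathsf M)$, are interpreted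 in nonempty finite strings $w$ over $\Sigma$. Variables range over the positions $1,\dots,|w|$; index terms are built from variables, $1$ and $|w|$ by $+$ and $-$ (integer values); atoms are $a(t)$ ("$t$ is a position carrying the token $a\in\Sigma$"), $s=t$, $s\le t$ and $\mathrm{bit}(s,t)$ ("$s,t\ge 0$ and the coefficient of $2^t$ in the binary expansion of $s$ is $1$"); formulas are closed under $\neg,\wedge,\vee,\exists,\forall$ and $\mathsf M$, where $\mathsf M x\,\varphi$ holds iff $\varphi$ is true for more than half of the positions $x$. The associated classifier system has as sentences the $\alpha\leftrightarrow\varphi$, with $\varphi$ a sentence of $\mathrm{FO}(\mathsf M)$ and $\alpha$ a new nullary predicate, and as interpretations the pairs $(w,\hat\alpha)$ of a nonempty string and a truth value $\hat\alpha\in\{0,1\}$ for $\alpha$; a set of such sentences is true in $(w,\hat\alpha)$ iff all its members are. **Transformers.** For $p\in\mathbb N$ let $\mathbb F_p=\{m2^e: m,e\in\mathbb Z,\ |m|<2^p,\ |e|\le p\}$, and let $\mathrm{rnd}_p$ be rounding towards zero to $\mathbb F_p$ (overflow saturates). A (logarithmic-precision) transformer over $\Sigma$ has a dimension $d$, a number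 of blocks, a precision constant $c\in\mathbb N$, and rational weights, all independent of the input length; on inputs of length $n$ it computes with precision $p=c(\lfloor\log_2 n\rfloor+1)$: the result of every arithmetic operation ($+,-,\cdot,/,\sqrt{\ }$), and every exactly formed sum over coordinates or positions, is rounded by $\mathrm{rnd}_p$. (Division by zero and roots of negative numbers yield $0$.) It consists of (i) an embedding of a token at position $j$ as the sum of a token vector and a position vector; (ii) blocks, each consisting of multi-head attention (affine query, key and value maps, scores $\langle q_j,k_l\rangle/\sqrt{e}$ with $e$ the head dimension, each head with or without a causal mask, weights $\omega(s_{jl}-\max_{l'}s_{jl'})$ normalized by their sum over the attended positions, and an affine combination of the heads) and a feed-forward subnet with one hidden layer and activation function $\sigma$, both with residual connections and optional layer normalizations before the sublayer and after the residual connection; (iii) an optional final layer normalization and an affine classifier, applied to the vector at the last position, whose output label is $1$ iff its value is positive. The weight function $\omega$ (an implementation of $\exp$ in the case of softmax), the activation $\sigma$ and each position coordinate are arbitrary functions that are uniformly computable in the following sense: measured in units of $2^{-p}$, and before rounding, their values are differences of two lower elementary functions of $2^p$ and the positive and negative parts of the argument (for position coordinates, of $2^p$, $n$ and the position). The *lower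 elementary* functions $\mathbb N^k\to\mathbb N$ are the least class that contains constants, projections, sums and truncated differences and is closed under composition and bounded summation $\sum_{y\le x}$. The transformer is regarded as a network whose states consist of an input string $w$ of arbitrary length $n\ge1$, an output label in $\{0,1\}$, and real hidden activations for all layers and positions. Tokens and labels carry the discrete metric and activations the supremum metric, and states for inputs of different lengths are at distance at least $1$. One update keeps $w$ and recomputes each layer from the current values of the preceding one and the label from the current values of the last layer. The input and output neurons are visible, all others are hidden, and the computation time is $1$. The encoding function is $i(x)=\{(w,\hat\alpha)\}$, where $w$ is the input string and $\hat\alpha$ the output label in the state $x$. **Proposition.** Let $T$ be a transformer over a finite nonempty alphabet $\Sigma$. Then $T$ is stable, and there is a single sentence $\varphi$ of $\mathrm{FO}(\mathsf M)$, valid for all input lengths, such that $T$ is a semantic encoding of the knowledge-base $\{\alpha\leftrightarrow\varphi\}$ under $i$ and $Agg=\bigcup$. -/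

import Mathlib

open Set Filter Topology

universe u

/-! ## Logical systems, candidate networks and semantic encodings -/

/-- A logical system: a language together with a family of interpretations, each of which
decides the truth of every knowledge-base (set of sentences). -/
structure LogicalSystem where
  Sentence : Type u
  Interp : Type u
  /-- `truth M L` means that `L` is true in `M`, i.e. that `M` is a model of `L`. -/
  truth : Interp → Set Sentence → Prop

namespace LogicalSystem

/-- The set of models of a knowledge-base. -/
def models (S : LogicalSystem.{u}) (L : Set S.Sentence) : Set S.Interp :=
  {M | S.truth M L}

/-- Semantic entailment between knowledge-bases. -/
def Entails (S : LogicalSystem.{u}) (L L' : Set S.Sentence) : Prop :=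
  ∀ M : S.Interp, S.truth M L → S.truth M L'

/-- The sentence `α ↔ φ`, where `α` is a new nullary predicate and `φ` a sentence of `𝓛`. -/
structure AlphaIff (𝓛 : Type u) where
  body : 𝓛

/-- The system of logical classifiers over `S`: its sentences are the `α ↔ φ`, its
interpretations are the pairs of an interpretation of `S` and a truth value of `α`, and a
knowledge-base is true in an interpretation iff each of its members is. -/
def classifierSystem (S : LogicalSystem.{u}) : LogicalSystem.{u} where
  Sentence := AlphaIff S.Sentence
  Interp := S.Interp × Bool
  truth M K := ∀ ψ ∈ K, (M.2 = true ↔ S.truth M.1 {ψ.body})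

end LogicalSystem

/-- A candidate network: a metric state space, an update map, a projection of states to the
configuration of their visible units, and a positive computation time. -/
structure CandidateNetwork where
  State : Type u
  metric : MetricSpace State
  Visible : Type u
  vis : State → Visible
  step : State → State
  tc : ℕ
  tc_pos : 0 < tc

namespace CandidateNetwork

instance (N : CandidateNetwork.{u}) : MetricSpace N.State := N.metric

/-- One semantic update: the update map applied `tc` times. -/
def update (N : CandidateNetwork.{u}) : N.State → N.State := N.step^[N.tc]

/-- Two states are equivalent iff their visible configurations agree. -/
def Equivalent (N : CandidateNetwork.{u}) (x y : N.State) : Prop := N.vis x = N.vis y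

/-- The set of limit points of the dynamics. -/
def Xinf (N : CandidateNetwork.{u}) : Set N.State :=
  {x | ∃ (x₀ : N.State) (t : ℕ → ℕ), StrictMono t ∧
    Tendsto (fun k => N.update^[t k] x₀) atTop (𝓝 x)}

/-- A network is stable if every trajectory converges to the set of limit points. -/
def IsStable (N : CandidateNetwork.{u}) : Prop :=
  ∀ x : N.State, Tendsto (fun t : ℕ => Metric.infDist (N.update^[t] x) N.Xinf) atTop (𝓝 0)

/-- An encoding function: it sends a state to a set of interpretations, and equivalent states
to the same set. -/
structure EncodingFunction (N : CandidateNetwork.{u}) (S : LogicalSystem.{u}) where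
  toFun : N.State → Set S.Interp
  respects : ∀ x y, N.Equivalent x y → toFun x = toFun y

variable {N : CandidateNetwork.{u}} {S : LogicalSystem.{u}}

/-- The set of interpretations represented by the network. -/
def represented (i : EncodingFunction N S) (Agg : Set (Set S.Interp) → Set S.Interp) :
    Set S.Interp :=
  Agg (i.toFun '' N.Xinf)

/-- `N` is a neural model of the knowledge-base `L` under `i` and `Agg`. -/
def IsNeuralModel (i : EncodingFunction N S) (Agg : Set (Set S.Interp) → Set S.Interp)
    (L : Set S.Sentence) : Prop :=
  (represented i Agg).Nonempty ∧ represented i Agg ⊆ S.models L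

/-- `N` is a semantic encoding of the knowledge-base `L` under `i` and `Agg`. -/
def IsSemanticEncoding (i : EncodingFunction N S) (Agg : Set (Set S.Interp) → Set S.Interp)
    (L : Set S.Sentence) : Prop :=
  IsNeuralModel i Agg L ∧
    ∀ L' : Set S.Sentence, S.Entails L L' ↔ represented i Agg ⊆ S.models L'

end CandidateNetwork

/-! ## First-order logic with majority quantifiers over strings -/

/-- Nonempty strings; the string `⟨n, w⟩` has length `n + 1`. -/
abbrev Str (α : Type u) : Type u := Σ n : ℕ, (Fin (n + 1) → α)

namespace FOM

/-- Index terms in the variables `x₀, …, x_{k-1}`. -/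
inductive Term (k : ℕ) : Type
  | var (i : Fin k) : Term k
  | one : Term k
  | len : Term k
  | add (s t : Term k) : Term k
  | sub (s t : Term k) : Term k

/-- The value of an index term in a string of length `n`, the variables being interpreted by
positions `1, …, n`. -/
def Term.eval {k : ℕ} (n : ℕ) (v : Fin k → ℕ) : Term k → ℤ
  | .var i => (v i : ℤ)
  | .one => 1
  | .len => (n : ℤ)
  | .add s t => s.eval n v + t.eval n v
  | .sub s t => s.eval n v - t.eval n v

/-- Formulas of first-order logic with majority quantifiers over the alphabet `α`, with free
variables among `x₀, …, x_{k-1}`; a quantifier binds `x_k`. -/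
inductive Formula (α : Type u) : ℕ → Type u
  | token {k : ℕ} (a : α) (t : Term k) : Formula α k
  | eq {k : ℕ} (s t : Term k) : Formula α k
  | le {k : ℕ} (s t : Term k) : Formula α k
  | bit {k : ℕ} (s t : Term k) : Formula α k
  | not {k : ℕ} (φ : Formula α k) : Formula α k
  | and {k : ℕ} (φ ψ : Formula α k) : Formula α k
  | or {k : ℕ} (φ ψ : Formula α k) : Formula α k
  | ex {k : ℕ} (φ : Formula α (k + 1)) : Formula α k
  | all {k : ℕ} (φ : Formula α (k + 1)) : Formula α k
  | maj {k : ℕ} (φ : Formula α (k + 1)) : Formula α k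

/-- A sentence is a formula without free variables. -/
abbrev Sentence (α : Type u) : Type u := Formula α 0

open Classical in
/-- Satisfaction in the string `w`. Quantifiers range over the positions `1, …, |w|`, and
`maj φ` holds iff `φ` is true for more than half of them; `token a t` says that `t` denotes a
position carrying the token `a`; `bit s t` says that the values `x` of `s` and `j` of `t` are
nonnegative and that the coefficient of `2 ^ j` in the binary expansion of `x` is `1`. -/
def Formula.Sat {α : Type u} (w : Str α) : {k : ℕ} → Formula α k → (Fin k → ℕ) → Prop
  | _, .token a t, v => ∃ p : Fin (w.1 + 1), t.eval (w.1 + 1) v = (p : ℤ) + 1 ∧ w.2 p = a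
  | _, .eq s t, v => s.eval (w.1 + 1) v = t.eval (w.1 + 1) v
  | _, .le s t, v => s.eval (w.1 + 1) v ≤ t.eval (w.1 + 1) v
  | _, .bit s t, v => 0 ≤ s.eval (w.1 + 1) v ∧ 0 ≤ t.eval (w.1 + 1) v ∧
      (s.eval (w.1 + 1) v).toNat.testBit (t.eval (w.1 + 1) v).toNat = true
  | _, .not φ, v => ¬ φ.Sat w v
  | _, .and φ ψ, v => φ.Sat w v ∧ ψ.Sat w v
  | _, .or φ ψ, v => φ.Sat w v ∨ ψ.Sat w v
  | _, .ex φ, v => ∃ x ∈ Finset.Icc 1 (w.1 + 1), φ.Sat w (Fin.snoc (α := fun _ => ℕ) v x)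
  | _, .all φ, v => ∀ x ∈ Finset.Icc 1 (w.1 + 1), φ.Sat w (Fin.snoc (α := fun _ => ℕ) v x)
  | _, .maj φ, v => w.1 + 1 <
      2 * ((Finset.Icc 1 (w.1 + 1)).filter
        (fun x => φ.Sat w (Fin.snoc (α := fun _ => ℕ) v x))).card

/-- The logical system of first-order logic with majority quantifiers: interpretations are
strings, and a knowledge-base is true in a string iff all its members are. -/
def system (α : Type u) : LogicalSystem.{u} where
  Sentence := Sentence α
  Interp := Str α
  truth w L := ∀ φ ∈ L, φ.Sat w Fin.elim0

end FOM

/-! ## Logarithmic-precision arithmetic -/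

/-- The lower elementary functions of natural numbers (in the sense of Skolem): the least class
that contains the constants, projections, sums and truncated differences and is closed under
composition and bounded summation. -/
inductive LowerElementary : {k : ℕ} → ((Fin k → ℕ) → ℕ) → Prop
  | const {k : ℕ} (c : ℕ) : LowerElementary (fun _ : Fin k → ℕ => c)
  | proj {k : ℕ} (i : Fin k) : LowerElementary (fun v : Fin k → ℕ => v i)
  | add {k : ℕ} {f g : (Fin k → ℕ) → ℕ} (hf : LowerElementary f) (hg : LowerElementary g) :
      LowerElementary (fun v => f v + g v)
  | sub {k : ℕ} {f g : (Fin k → ℕ) → ℕ} (hf : LowerElementary f) (hg : LowerElementary g) :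
      LowerElementary (fun v => f v - g v)
  | comp {k l : ℕ} {f : (Fin k → ℕ) → ℕ} {g : Fin k → (Fin l → ℕ) → ℕ}
      (hf : LowerElementary f) (hg : ∀ i, LowerElementary (g i)) :
      LowerElementary (fun v => f (fun i => g i v))
  | bsum {k : ℕ} {f : (Fin (k + 1) → ℕ) → ℕ} (hf : LowerElementary f) :
      LowerElementary (fun v : Fin (k + 1) → ℕ =>
        ∑ y ∈ Finset.range (v (Fin.last k) + 1), f (Fin.snoc (α := fun _ => ℕ) (Fin.init v) y))

/-- An integer-valued function presented as a difference of lower elementary functions. -/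
structure UniformMap (k : ℕ) where
  pos : (Fin k → ℕ) → ℕ
  neg : (Fin k → ℕ) → ℕ
  pos_le : LowerElementary pos
  neg_le : LowerElementary neg

/-- The value of a uniform map. -/
def UniformMap.eval {k : ℕ} (f : UniformMap k) (v : Fin k → ℕ) : ℤ := (f.pos v : ℤ) - f.neg v

/-- The floating-point numbers of precision `p`: `m * 2 ^ e` with a mantissa of `p` bits. -/
def floats (p : ℕ) : Set ℝ :=
  {y | ∃ m e : ℤ, |m| < 2 ^ p ∧ |e| ≤ (p : ℤ) ∧ y = (m : ℝ) * (2 : ℝ) ^ e}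

/-- Rounding towards zero to precision `p`: for `x ≥ 0` the greatest float that is at most `x`
(so that overflow saturates and underflow gives zero), and `rnd p (-x) = -rnd p x`. -/
noncomputable def rnd (p : ℕ) (x : ℝ) : ℝ :=
  if 0 ≤ x then sSup {y | y ∈ floats p ∧ y ≤ x} else -sSup {y | y ∈ floats p ∧ y ≤ -x}

/-- The precision `p`-implementation of a scalar function that is specified by a uniform map in
the arguments `2 ^ p`, `k⁺`, `k⁻`, where `k = ⌊x * 2 ^ p⌋` is the argument in units of `2 ^ (-p)`
(all floats are integer multiples of this unit); the value is also in these units. -/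
noncomputable def UniformMap.scalar (f : UniformMap 3) (p : ℕ) (x : ℝ) : ℝ :=
  rnd p ((f.eval ![2 ^ p, ⌊x * 2 ^ p⌋.toNat, (-⌊x * 2 ^ p⌋).toNat] : ℝ) / 2 ^ p)

/-- The precision `p`-value of a positional feature at position `i` of a string of length `n`,
specified by a uniform map in the arguments `2 ^ p`, `n`, `i`. -/
noncomputable def UniformMap.position (f : UniformMap 3) (p n i : ℕ) : ℝ :=
  rnd p ((f.eval ![2 ^ p, n, i] : ℝ) / 2 ^ p)

/-- Inner product in precision `p`: all products are rounded, their exact sum is rounded once. -/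
noncomputable def fdot (p : ℕ) {ι : Type*} (s : Finset ι) (x y : ι → ℝ) : ℝ :=
  rnd p (∑ j ∈ s, rnd p (x j * y j))

/-! ## Transformers -/

/-- An affine map with rational parameters. -/
structure AffineMapQ (ι κ : Type) where
  weight : κ → ι → ℚ
  bias : κ → ℚ

/-- Application of an affine map in precision `p`. -/
noncomputable def AffineMapQ.apply {ι κ : Type} [Fintype ι] (A : AffineMapQ ι κ) (p : ℕ)
    (x : ι → ℝ) (k : κ) : ℝ :=
  rnd p (fdot p Finset.univ (fun j => rnd p (A.weight k j)) x + rnd p (A.bias k))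

/-- The parameters of a layer normalization. -/
structure LayerNorm (d : ℕ) where
  gain : Fin d → ℚ
  shift : Fin d → ℚ
  eps : ℚ

/-- Layer normalization in precision `p`:
`gain * (x - mean x) / sqrt (variance x + eps) + shift`. -/
noncomputable def LayerNorm.apply {d : ℕ} (N : LayerNorm d) (p : ℕ) (x : Fin d → ℝ) :
    Fin d → ℝ :=
  let mean := rnd p (rnd p (∑ k, x k) / d)
  let y : Fin d → ℝ := fun k => rnd p (x k - mean)
  let var := rnd p (fdot p Finset.univ y y / d)
  let sd := rnd p (√(rnd p (var + rnd p N.eps)))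
  fun k => rnd p (rnd p (rnd p (N.gain k) * rnd p (y k / sd)) + rnd p (N.shift k))

/-- An optional layer normalization (the identity if absent). -/
noncomputable def applyNorm {d : ℕ} (N : Option (LayerNorm d)) (p : ℕ) (x : Fin d → ℝ) :
    Fin d → ℝ :=
  match N with
  | none => x
  | some N => N.apply p x

/-- An attention head of dimension `e` on vectors of dimension `d`: query, key and value maps,
and a flag that says whether the head is causally masked. -/
structure Head (d e : ℕ) where
  query : AffineMapQ (Fin d) (Fin e)
  key : AffineMapQ (Fin d) (Fin e)
  value : AffineMapQ (Fin d) (Fin e)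
  causal : Bool

namespace Head

variable {d e : ℕ}

/-- The positions that position `i` attends to. -/
def visible (H : Head d e) {n : ℕ} (i : Fin n) : Finset (Fin n) :=
  Finset.univ.filter fun j => H.causal = true → j ≤ i

/-- A position attends at least to itself. -/
theorem visible_nonempty (H : Head d e) {n : ℕ} (i : Fin n) : (H.visible i).Nonempty :=
  ⟨i, by simp [visible]⟩

/-- The scaled dot-product score of position `j` for position `i`. -/
noncomputable def score (H : Head d e) (p : ℕ) {n : ℕ} (x : Fin n → Fin d → ℝ) (i j : Fin n) :
    ℝ :=
  rnd p (fdot p Finset.univ (H.query.apply p (x i)) (H.key.apply p (x j)) / rnd p (√(e : ℝ)))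

/-- The unnormalized attention weight of position `j` for position `i`: the weight function is
applied to the score minus the maximal score. -/
noncomputable def rawWeight (H : Head d e) (ω : UniformMap 3) (p : ℕ) {n : ℕ}
    (x : Fin n → Fin d → ℝ) (i j : Fin n) : ℝ :=
  ω.scalar p
    (rnd p (H.score p x i j - (H.visible i).sup' (H.visible_nonempty i) (H.score p x i)))

/-- The output of the head at position `i`: the average of the values of the visible positions
with the normalized attention weights. -/
noncomputable def output (H : Head d e) (ω : UniformMap 3) (p : ℕ) {n : ℕ}
    (x : Fin n → Fin d → ℝ) (i : Fin n) (k : Fin e) : ℝ :=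
  let Z := rnd p (∑ j ∈ H.visible i, H.rawWeight ω p x i j)
  fdot p (H.visible i) (fun j => rnd p (H.rawWeight ω p x i j / Z))
    (fun j => H.value.apply p (x j) k)

end Head

/-- A transformer block: multi-head attention and a feed-forward subnet with one hidden layer,
each with a residual connection and optional layer normalizations before the sublayer (pre-norm)
and after the residual connection (post-norm). -/
structure Block (d : ℕ) where
  numHeads : ℕ
  headDim : ℕ
  width : ℕ
  heads : Fin numHeads → Head d headDim
  combine : AffineMapQ (Fin numHeads × Fin headDim) (Fin d)
  inner : AffineMapQ (Fin d) (Fin width)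
  outer : AffineMapQ (Fin width) (Fin d)
  preAttention : Option (LayerNorm d)
  postAttention : Option (LayerNorm d)
  preFeedForward : Option (LayerNorm d)
  postFeedForward : Option (LayerNorm d)

/-- The map computed by a block with attention weight function `ω` and activation function `σ`
in precision `p`. -/
noncomputable def Block.apply {d : ℕ} (B : Block d) (ω σ : UniformMap 3) (p : ℕ) {n : ℕ}
    (x : Fin n → Fin d → ℝ) : Fin n → Fin d → ℝ :=
  let y : Fin n → Fin d → ℝ := fun i => applyNorm B.preAttention p (x i)
  let z : Fin n → Fin d → ℝ := fun i =>
    applyNorm B.postAttention p fun k =>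
      rnd p (x i k + B.combine.apply p (fun hk => (B.heads hk.1).output ω p y i hk.2) k)
  fun i =>
    applyNorm B.postFeedForward p fun k =>
      rnd p (z i k + B.outer.apply p
        (fun l => σ.scalar p (B.inner.apply p (applyNorm B.preFeedForward p (z i)) l)) k)

/-- A logarithmic-precision transformer classifier over the alphabet `α`. None of its parameters
depends on the length of the input. -/
structure Transformer (α : Type u) where
  /-- dimension of the model -/
  dim : ℕ
  /-- number of blocks -/
  depth : ℕ
  /-- the precision on inputs of length `n` is `precision` times the number of bits of `n` -/
  precision : ℕ
  tokenEmbedding : α → Fin dim → ℚ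
  positionEmbedding : Fin dim → UniformMap 3
  /-- weight function of the attention (for softmax: an implementation of `exp`) -/
  attentionWeight : UniformMap 3
  /-- activation function of the feed-forward subnets (for example ReLU) -/
  activation : UniformMap 3
  blocks : Fin depth → Block dim
  finalNorm : Option (LayerNorm dim)
  classifier : AffineMapQ (Fin dim) Unit

namespace Transformer

variable {α : Type u}

/-- The number of bits of precision on inputs of length `n`. -/
def bits (T : Transformer α) (n : ℕ) : ℕ := T.precision * Nat.size n

/-- The embedding layer; positions are numbered from `1`. -/
noncomputable def embed (T : Transformer α) {n : ℕ} (w : Fin n → α) (i : Fin n) (k : Fin T.dim) :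
    ℝ :=
  rnd (T.bits n) (rnd (T.bits n) (T.tokenEmbedding (w i) k) +
    (T.positionEmbedding k).position (T.bits n) n (i + 1))

/-- The output label, computed from the last position of the last layer. -/
noncomputable def classify (T : Transformer α) {n : ℕ} (x : Fin (n + 1) → Fin T.dim → ℝ) : Bool :=
  decide (0 < T.classifier.apply (T.bits (n + 1))
    (applyNorm T.finalNorm (T.bits (n + 1)) (x (Fin.last n))) ())

/-- The activations of the hidden neurons: one vector for each layer and position, layer `0`
being the embedding layer. -/
abbrev Hidden (T : Transformer α) (n : ℕ) : Type :=
  Fin (T.depth + 1) → Fin (n + 1) → Fin T.dim → ℝ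

/-- A state: an input string, the output label, and the hidden activations. -/
abbrev State (T : Transformer α) : Type u :=
  Σ n : ℕ, (Fin (n + 1) → α) × Bool × T.Hidden n

open Classical in
/-- The metric in which distinct points are at distance `1`. -/
noncomputable abbrev discreteMetric (β : Type*) : MetricSpace β where
  dist x y := if x = y then 0 else 1
  dist_self x := by simp
  dist_comm x y := by simp [eq_comm]
  dist_triangle x y z := by
    by_cases h : x = y
    · simp [h]
    · by_cases h' : x = z
      · simp only [h', if_true]; split_ifs <;> norm_num
      · simp only [h, h', if_false]; split_ifs <;> norm_num
  eq_of_dist_eq_zero {x y} h := by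
    by_contra hne
    simp [hne] at h

/-- The metric of the state space: tokens and labels are discrete, activations carry the
supremum metric, and states for inputs of different lengths are at distance at least `1`. -/
noncomputable abbrev stateMetric (T : Transformer α) : MetricSpace T.State :=
  letI : MetricSpace α := discreteMetric α
  letI : MetricSpace Bool := discreteMetric Bool
  Metric.Sigma.metricSpace

/-- One update of all neurons: the input is clamped, every layer is computed from the current
values of the previous one, and the output from the current values of the last layer. -/
noncomputable def step (T : Transformer α) : T.State → T.State
  | ⟨n, w, _, h⟩ => ⟨n, w, T.classify (h (Fin.last T.depth)),
      Fin.cases (T.embed w) fun l =>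
        (T.blocks l).apply T.attentionWeight T.activation (T.bits (n + 1)) (h l.castSucc)⟩

/-- The transformer as a candidate network: the input and output neurons are visible and the
computation time is `1`. -/
noncomputable def network (T : Transformer α) : CandidateNetwork.{u} where
  State := T.State
  metric := T.stateMetric
  Visible := Str α × Bool
  vis := fun x => (⟨x.1, x.2.1⟩, x.2.2.1)
  step := T.step
  tc := 1
  tc_pos := Nat.one_pos

/-- The encoding function: a state represents the interpretation given by its input string and
by the truth value for `α` that its output label indicates. -/
noncomputable def encoding (T : Transformer α) :
    T.network.EncodingFunction (FOM.system α).classifierSystem where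
  toFun := fun x => {T.network.vis x}
  respects := fun _ _ h => congrArg (fun v => ({v} : Set (Str α × Bool))) h

end Transformer

/-!
In units of `2 ^ (-p)`, the values that a transformer computes on a string of length `n` are
integers of size polynomial in `n`, up to sign. Such a number is a tuple of boundedly many digits
in a base of order `n ^ (1/3)`, so that pairs of digits, and a factor `3` to spare, are coded by
positions. A majority quantifier, on padded domains, counts the positions with a definable
property, hence compares a sum of digits over a definable range with a position; this gives the
digits of sums of polynomially many numbers, and from these products, quotients, square roots,
roundings, lower elementary functions and, finally, attention. The finitely many strings that are
too short for the digits are described one by one.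

Whatever its initial state, the network on the input `w` has after `depth + 2` updates the values of
the feed-forward evaluation on `w`. So the limit states are exactly these fixed points, and the
interpretations that they represent are the pairs of a string and its label.
-/

namespace FOM

variable {α : Type u} {k m : ℕ}

/-! ## Substitution in formulas -/

/-- Renaming of the variables of an index term. -/
def Term.rename (ρ : Fin k → Fin m) : Term k → Term m
  | .var i => .var (ρ i)
  | .one => .one
  | .len => .len
  | .add s t => .add (s.rename ρ) (t.rename ρ)
  | .sub s t => .sub (s.rename ρ) (t.rename ρ)

theorem Term.eval_rename (ρ : Fin k → Fin m) (t : Term k) (n : ℕ) (v : Fin m → ℕ) :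
    (t.rename ρ).eval n v = t.eval n (v ∘ ρ) := by
  induction t with
  | var i => rfl
  | one => rfl
  | len => rfl
  | add s t hs ht => simp only [rename, eval, hs, ht]
  | sub s t hs ht => simp only [rename, eval, hs, ht]

/-- The renaming that fixes the variable bound by a quantifier and acts as `ρ` on the others. -/
def liftRenaming (ρ : Fin k → Fin m) : Fin (k + 1) → Fin (m + 1) :=
  Fin.snoc (α := fun _ => Fin (m + 1)) (Fin.castSucc ∘ ρ) (Fin.last m)

theorem snoc_comp_liftRenaming (ρ : Fin k → Fin m) (v : Fin m → ℕ) (x : ℕ) :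
    Fin.snoc (α := fun _ => ℕ) v x ∘ liftRenaming ρ = Fin.snoc (α := fun _ => ℕ) (v ∘ ρ) x := by
  funext i
  refine Fin.lastCases ?_ (fun i => ?_) i <;> simp [liftRenaming]

/-- Renaming of the free variables of a formula. -/
def Formula.rename : {k m : ℕ} → (Fin k → Fin m) → Formula α k → Formula α m
  | _, _, ρ, .token a t => .token a (t.rename ρ)
  | _, _, ρ, .eq s t => .eq (s.rename ρ) (t.rename ρ)
  | _, _, ρ, .le s t => .le (s.rename ρ) (t.rename ρ)
  | _, _, ρ, .bit s t => .bit (s.rename ρ) (t.rename ρ)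
  | _, _, ρ, .not φ => .not (φ.rename ρ)
  | _, _, ρ, .and φ ψ => .and (φ.rename ρ) (ψ.rename ρ)
  | _, _, ρ, .or φ ψ => .or (φ.rename ρ) (ψ.rename ρ)
  | _, _, ρ, .ex φ => .ex (φ.rename (liftRenaming ρ))
  | _, _, ρ, .all φ => .all (φ.rename (liftRenaming ρ))
  | _, _, ρ, .maj φ => .maj (φ.rename (liftRenaming ρ))

open Classical in
theorem Formula.sat_rename (φ : Formula α k) (ρ : Fin k → Fin m) (w : Str α) (v : Fin m → ℕ) :
    (φ.rename ρ).Sat w v ↔ φ.Sat w (v ∘ ρ) := by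
  induction φ generalizing m with
  | token a t => simp only [rename, Sat, Term.eval_rename]
  | eq s t => simp only [rename, Sat, Term.eval_rename]
  | le s t => simp only [rename, Sat, Term.eval_rename]
  | bit s t => simp only [rename, Sat, Term.eval_rename]
  | not φ ih => simp only [rename, Sat, ih]
  | and φ ψ ih ih' => simp only [rename, Sat, ih, ih']
  | or φ ψ ih ih' => simp only [rename, Sat, ih, ih']
  | ex φ ih => simp only [rename, Sat, ih, snoc_comp_liftRenaming]
  | all φ ih => simp only [rename, Sat, ih, snoc_comp_liftRenaming]
  | maj φ ih =>
    simp only [rename, Sat]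
    rw [Finset.filter_congr fun x _ => by rw [ih, snoc_comp_liftRenaming]]

/-- Strings of length at least `8`; on these, `2` and the powers of the base in which numbers are
represented below are small compared to the length. -/
abbrev LongStr (α : Type u) : Type u := {w : Str α // 7 ≤ w.1}

/-- A long string together with values of `k` variables. The values are positions numbered from
`0`, whereas the semantics of formulas numbers them from `1`. -/
structure Assignment (α : Type u) (k : ℕ) where
  str : LongStr α
  pos : Fin k → Fin (str.1.1 + 1)

namespace Assignment

/-- The values of the variables in the numbering used by the semantics of formulas. -/
def vals (e : Assignment α k) (i : Fin k) : ℕ := e.pos i + 1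

/-- Extension of an assignment by a value of a further variable. -/
def snoc (e : Assignment α k) (x : Fin (e.str.1.1 + 1)) : Assignment α (k + 1) :=
  ⟨e.str, Fin.snoc (α := fun _ => Fin (e.str.1.1 + 1)) e.pos x⟩

/-- The assignment that is obtained by renaming the variables. -/
def rename (e : Assignment α m) (ρ : Fin k → Fin m) : Assignment α k := ⟨e.str, e.pos ∘ ρ⟩

/-- The assignment without the value of the last variable. -/
def init (e : Assignment α (k + 1)) : Assignment α k := e.rename Fin.castSucc

/-- The value of the last variable. -/
def last (e : Assignment α (k + 1)) : ℕ := e.pos (Fin.last k)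

theorem last_le (e : Assignment α (k + 1)) : e.last ≤ e.str.1.1 := Nat.lt_succ_iff.1 (e.pos _).2

@[simp]
theorem init_snoc (e : Assignment α k) (x : Fin (e.str.1.1 + 1)) : (e.snoc x).init = e := by
  simp only [init, rename, snoc]
  congr 1
  funext i
  simp

@[simp]
theorem last_snoc (e : Assignment α k) (x : Fin (e.str.1.1 + 1)) : (e.snoc x).last = x := by
  simp [last, snoc]

theorem vals_snoc (e : Assignment α k) (x : Fin (e.str.1.1 + 1)) :
    (e.snoc x).vals = Fin.snoc (α := fun _ => ℕ) e.vals (x + 1) := by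
  funext i
  refine Fin.lastCases ?_ (fun i => ?_) i <;> simp [vals, snoc]

theorem init_rename_liftRenaming (e : Assignment α (m + 1)) (ρ : Fin k → Fin m) :
    (e.rename (liftRenaming ρ)).init = e.init.rename ρ :=
  congrArg (mk e.str) <| funext fun i => by simp [init, rename, liftRenaming]

theorem last_rename_liftRenaming (e : Assignment α (m + 1)) (ρ : Fin k → Fin m) :
    (e.rename (liftRenaming ρ)).last = e.last := by
  simp [last, rename, liftRenaming]

end Assignment

/-- A relation between positions that is defined by a formula. -/
def FormulaDefinable (R : Assignment α k → Prop) : Prop :=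
  ∃ φ : Formula α k, ∀ e, φ.Sat e.str.1 e.vals ↔ R e

/-- A function from positions to positions whose graph is defined by a formula. -/
structure PositionDefinable (f : Assignment α k → ℕ) : Prop where
  le : ∀ e, f e ≤ e.str.1.1
  graph : FormulaDefinable fun e : Assignment α (k + 1) => f e.init = e.last

namespace FormulaDefinable

theorem rename {R : Assignment α k → Prop} (hR : FormulaDefinable R) (ρ : Fin k → Fin m) :
    FormulaDefinable fun e => R (e.rename ρ) := by
  obtain ⟨φ, hφ⟩ := hR
  exact ⟨φ.rename ρ, fun e => (φ.sat_rename ρ _ _).trans (hφ (e.rename ρ))⟩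

theorem not {R : Assignment α k → Prop} (hR : FormulaDefinable R) :
    FormulaDefinable fun e => ¬ R e := by
  obtain ⟨φ, hφ⟩ := hR
  exact ⟨.not φ, fun e => not_congr (hφ e)⟩

theorem and {R S : Assignment α k → Prop} (hR : FormulaDefinable R) (hS : FormulaDefinable S) :
    FormulaDefinable fun e => R e ∧ S e := by
  obtain ⟨φ, hφ⟩ := hR
  obtain ⟨ψ, hψ⟩ := hS
  exact ⟨.and φ ψ, fun e => and_congr (hφ e) (hψ e)⟩

theorem exists_snoc {R : Assignment α (k + 1) → Prop} (hR : FormulaDefinable R) :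
    FormulaDefinable fun e => ∃ x, R (e.snoc x) := by
  obtain ⟨φ, hφ⟩ := hR
  refine ⟨.ex φ, fun e => ?_⟩
  simp only [Formula.Sat, ← hφ, Assignment.vals_snoc, Finset.mem_Icc]
  constructor
  · rintro ⟨x, hx, h⟩
    exact ⟨⟨x - 1, by omega⟩, by rwa [Nat.sub_add_cancel hx.1]⟩
  · rintro ⟨x, h⟩
    exact ⟨x + 1, ⟨by omega, by omega⟩, h⟩

theorem majority_snoc {R : Assignment α (k + 1) → Prop} [DecidablePred R]
    (hR : FormulaDefinable R) :
    FormulaDefinable fun e : Assignment α k =>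
      e.str.1.1 + 1 < 2 * (Finset.univ.filter fun x => R (e.snoc x)).card := by
  classical
  obtain ⟨φ, hφ⟩ := hR
  refine ⟨.maj φ, fun e => ?_⟩
  have card_eq : (Finset.univ.filter fun x => R (e.snoc x)).card =
      ((Finset.Icc 1 (e.str.1.1 + 1)).filter fun x =>
        φ.Sat e.str.1 (Fin.snoc (α := fun _ => ℕ) e.vals x)).card := by
    refine Finset.card_bij (fun x _ => (x : ℕ) + 1) (fun x hx => ?_)
      (fun x _ y _ h => Fin.ext (Nat.succ_injective h)) fun x hx => ?_
    · simp only [Finset.mem_filter, Finset.mem_univ, true_and, Finset.mem_Icc, ← hφ,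
        Assignment.vals_snoc] at hx ⊢
      exact ⟨⟨by omega, by omega⟩, hx⟩
    · simp only [Finset.mem_filter, Finset.mem_Icc] at hx
      obtain ⟨⟨one_le, hle⟩, h⟩ := hx
      refine ⟨⟨x - 1, by omega⟩, ?_, Nat.sub_add_cancel one_le⟩
      simp only [Finset.mem_filter, Finset.mem_univ, true_and, ← hφ, Assignment.vals_snoc]
      rwa [Nat.sub_add_cancel one_le]
  simp only [Formula.Sat, card_eq]

theorem sat_append : ∀ {m : ℕ} (φ : Formula α (k + m)) {g : Fin m → Assignment α k → ℕ},
    (∀ i, PositionDefinable (g i)) →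
      FormulaDefinable fun e => φ.Sat e.str.1 (Fin.append e.vals fun i => g i e + 1)
  | 0, φ, g, _ => ⟨φ, fun e => iff_of_eq <| congrArg (φ.Sat e.str.1)
      (Fin.append_right_nil e.vals (fun i => g i e + 1) rfl).symm⟩
  | m + 1, φ, g, hg => by
    obtain ⟨γ, hγ⟩ := (hg (Fin.last m)).graph
    obtain ⟨ψ, hψ⟩ := sat_append (.ex (.and (γ.rename (liftRenaming (Fin.castAdd m))) φ))
      (g := fun i => g i.castSucc) fun i => hg i.castSucc
    refine ⟨ψ, fun e => (hψ e).trans ?_⟩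
    have le := (hg (Fin.last m)).le e
    have graph_iff : ∀ x ∈ Finset.Icc 1 (e.str.1.1 + 1),
        (γ.Sat e.str.1 (Fin.snoc (α := fun _ => ℕ) e.vals x) ↔ x = g (Fin.last m) e + 1) := by
      intro x hx
      obtain ⟨one_le, x_le⟩ := Finset.mem_Icc.1 hx
      have := hγ (e.snoc ⟨x - 1, by omega⟩)
      simp only [Assignment.vals_snoc, Assignment.init_snoc, Assignment.last_snoc,
        Nat.sub_add_cancel one_le] at this
      exact this.trans (by omega)
    have append_castAdd : Fin.append e.vals (fun i => g (Fin.castSucc i) e + 1) ∘ Fin.castAdd m =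
        e.vals := funext fun i => Fin.append_left _ _ i
    have append_eq : Fin.snoc (α := fun _ => ℕ)
        (Fin.append e.vals fun i => g (Fin.castSucc i) e + 1) (g (Fin.last m) e + 1) =
        Fin.append e.vals fun i => g i e + 1 := by
      rw [← Fin.append_snoc]
      congr 1
      exact Fin.snoc_init_self (α := fun _ => ℕ) fun i => g i e + 1
    simp only [Formula.Sat, Formula.sat_rename, snoc_comp_liftRenaming, append_castAdd]
    constructor
    · rintro ⟨x, hx, hγx, hφ⟩
      rwa [(graph_iff x hx).1 hγx, append_eq] at hφ
    · intro hφ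
      have hx : g (Fin.last m) e + 1 ∈ Finset.Icc 1 (e.str.1.1 + 1) :=
        Finset.mem_Icc.2 ⟨by omega, by omega⟩
      exact ⟨_, hx, (graph_iff _ hx).2 rfl, append_eq ▸ hφ⟩

theorem sat (φ : Formula α m) {g : Fin m → Assignment α k → ℕ}
    (hg : ∀ i, PositionDefinable (g i)) :
    FormulaDefinable fun e => φ.Sat e.str.1 fun i => g i e + 1 := by
  obtain ⟨ψ, hψ⟩ := sat_append (φ.rename (Fin.natAdd k)) hg
  refine ⟨ψ, fun e => (hψ e).trans ?_⟩
  exact (φ.sat_rename _ _ _).trans <| iff_of_eq <| congrArg (φ.Sat e.str.1) <|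
    funext fun i => Fin.append_right _ _ i

end FormulaDefinable

namespace PositionDefinable

variable {f g : Assignment α k → ℕ}

theorem eq (hf : PositionDefinable f) (hg : PositionDefinable g) :
    FormulaDefinable fun e => f e = g e := by
  obtain ⟨φ, hφ⟩ := FormulaDefinable.sat (.eq (.var 0) (.var 1)) (g := ![f, g])
    (Fin.forall_fin_two.2 ⟨hf, hg⟩)
  exact ⟨φ, fun e => (hφ e).trans (by simp [Formula.Sat, Term.eval])⟩

theorem init (hf : PositionDefinable f) :
    PositionDefinable fun e : Assignment α (k + 1) => f e.init := by
  refine ⟨fun e => hf.le e.init, ?_⟩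
  have := hf.graph.rename (liftRenaming (Fin.castSucc : Fin k → Fin (k + 1)))
  simp only [Assignment.init_rename_liftRenaming, Assignment.last_rename_liftRenaming] at this
  exact this

theorem last : PositionDefinable fun e : Assignment α (k + 1) => e.last :=
  ⟨Assignment.last_le, .eq (.var (Fin.last k).castSucc) (.var (Fin.last (k + 1))), fun e => by
    simp [Formula.Sat, Term.eval, Assignment.vals, Assignment.last, Assignment.init,
      Assignment.rename]⟩

end PositionDefinable

/-! ## Contexts -/

/-- A type of environments, each of which comprises a long string. The admissible families of
environments over the assignments are those whose further components are given by definable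
functions; definability in the environment is tested on these families. -/
class Context (α : outParam (Type u)) (E : Type u) where
  str : E → LongStr α
  Adm : ∀ {k : ℕ}, (Assignment α k → E) → Prop
  str_eq : ∀ {k : ℕ} {γ : Assignment α k → E}, Adm γ → ∀ e, str (γ e) = e.str
  init : ∀ {k : ℕ} {γ : Assignment α k → E}, Adm γ → Adm fun e : Assignment α (k + 1) => γ e.init

open Context

instance : Context α (LongStr α) where
  str w := w
  Adm γ := ∀ e, γ e = e.str
  str_eq h := h
  init h _ := h _

variable {E E' E'' : Type u} [Context α E] [Context α E'] [Context α E'']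

/-- The last position of the string, that is, its length minus `1`. -/
def last (e : E) : ℕ := (str e).1.1

theorem seven_le_last (e : E) : 7 ≤ last e := (str e).2

theorem last_eq {γ : Assignment α k → E} (hγ : Adm γ) (e : Assignment α k) :
    last (γ e) = e.str.1.1 := by rw [last, str_eq hγ]

/-- Environments extended by a position of the string. -/
abbrev Pos (E : Type u) [Context α E] : Type u := (e : E) × Fin (last e + 1)

instance : Context α (Pos E) where
  str p := str p.1
  Adm γ := Adm (fun e => (γ e).1) ∧ PositionDefinable fun e => ((γ e).2 : ℕ)
  str_eq h := str_eq h.1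
  init h := ⟨init h.1, h.2.init⟩

/-- A relation that is definable by formulas when its argument ranges over an admissible
family. -/
structure Definable (R : E → Prop) : Prop where
  of_adm : ∀ {k : ℕ} {γ : Assignment α k → E}, Adm γ → FormulaDefinable fun e => R (γ e)

/-- A definable position of the string. -/
structure IsPosition (f : E → ℕ) : Prop where
  of_adm : ∀ {k : ℕ} {γ : Assignment α k → E}, Adm γ → PositionDefinable fun e => f (γ e)

/-- A map between environments that keeps the string and preserves admissible families. -/
structure DefinableMap (g : E → E') : Prop where
  adm : ∀ {k : ℕ} {γ : Assignment α k → E}, Adm γ → Adm fun e => g (γ e)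
  str_eq : ∀ e, str (g e) = str e

namespace DefinableMap

theorem id : DefinableMap fun e : E => e := ⟨fun h => h, fun _ => rfl⟩

theorem comp {g : E' → E''} {h : E → E'} (hg : DefinableMap g) (hh : DefinableMap h) :
    DefinableMap fun e => g (h e) :=
  ⟨fun hγ => hg.adm (hh.adm hγ), fun e => (hg.str_eq _).trans (hh.str_eq e)⟩

theorem last_eq {g : E → E'} (hg : DefinableMap g) (e : E) : last (g e) = last e := by
  rw [last, hg.str_eq, last]

theorem pos_fst : DefinableMap (Sigma.fst : Pos E → E) := ⟨fun h => h.1, fun _ => rfl⟩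

theorem pos {g : E → E'} {f : ∀ e, Fin (last (g e) + 1)} (hg : DefinableMap g)
    (hf : IsPosition fun e => (f e : ℕ)) : DefinableMap fun e => (⟨g e, f e⟩ : Pos E') :=
  ⟨fun h => ⟨hg.adm h, hf.of_adm h⟩, hg.str_eq⟩

end DefinableMap

namespace IsPosition

theorem snd : IsPosition fun p : Pos E => (p.2 : ℕ) := ⟨fun h => h.2⟩

theorem comp {f : E' → ℕ} (hf : IsPosition f) {g : E → E'} (hg : DefinableMap g) :
    IsPosition fun e => f (g e) := ⟨fun h => hf.of_adm (hg.adm h)⟩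

theorem graph {f : E → ℕ} (hf : IsPosition f) : Definable fun p : Pos E => f p.1 = p.2 :=
  ⟨fun h => (hf.of_adm h.1).eq h.2⟩

end IsPosition

theorem adm_snoc {γ : Assignment α k → E} (hγ : Adm γ) :
    Adm fun e : Assignment α (k + 1) =>
      (⟨γ e.init, e.last, by rw [last_eq hγ]; exact Nat.lt_succ_of_le e.last_le⟩ : Pos E) :=
  ⟨init hγ, .last⟩

theorem IsPosition.of_graph {f : E → ℕ} (hle : ∀ e, f e ≤ last e)
    (hf : Definable fun p : Pos E => f p.1 = p.2) : IsPosition f :=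
  ⟨fun hγ => ⟨fun e => (hle _).trans_eq (last_eq hγ e), hf.of_adm (adm_snoc hγ)⟩⟩

namespace Definable

variable {R S : E → Prop}

theorem congr (hR : Definable R) (h : ∀ e, R e ↔ S e) : Definable S := funext (propext <| h ·) ▸ hR

theorem comp {R : E' → Prop} (hR : Definable R) {g : E → E'} (hg : DefinableMap g) :
    Definable fun e => R (g e) := ⟨fun h => hR.of_adm (hg.adm h)⟩

theorem not (hR : Definable R) : Definable fun e => ¬ R e := ⟨fun h => (hR.of_adm h).not⟩

theorem and (hR : Definable R) (hS : Definable S) : Definable fun e => R e ∧ S e :=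
  ⟨fun h => (hR.of_adm h).and (hS.of_adm h)⟩

theorem or (hR : Definable R) (hS : Definable S) : Definable fun e => R e ∨ S e :=
  (hR.not.and hS.not).not.congr fun _ => or_iff_not_and_not.symm

theorem imp (hR : Definable R) (hS : Definable S) : Definable fun e => R e → S e :=
  (hR.not.or hS).congr fun _ => imp_iff_not_or.symm

theorem iff (hR : Definable R) (hS : Definable S) : Definable fun e => R e ↔ S e :=
  ((hR.imp hS).and (hS.imp hR)).congr fun _ => iff_iff_implies_and_implies.symm

theorem exists_le {R : E → ℕ → Prop} (hR : Definable fun p : Pos E => R p.1 p.2) :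
    Definable fun e => ∃ x ≤ last e, R e x := by
  refine ⟨fun {k γ} hγ => ?_⟩
  convert (hR.of_adm (adm_snoc hγ)).exists_snoc with e
  simp only [Assignment.init_snoc, Assignment.last_snoc, last_eq hγ]
  exact ⟨fun ⟨x, hx, h⟩ => ⟨⟨x, Nat.lt_succ_of_le hx⟩, h⟩,
    fun ⟨x, h⟩ => ⟨x, Nat.lt_succ_iff.1 x.2, h⟩⟩

theorem forall_le {R : E → ℕ → Prop} (hR : Definable fun p : Pos E => R p.1 p.2) :
    Definable fun e => ∀ x ≤ last e, R e x :=
  (exists_le (R := fun e x => ¬ R e x) hR.not).not.congr fun _ => by push Not; rfl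

theorem majority {R : E → ℕ → Prop} [∀ e, DecidablePred (R e)]
    (hR : Definable fun p : Pos E => R p.1 p.2) :
    Definable fun e => last e + 1 < 2 * ((Finset.range (last e + 1)).filter (R e)).card := by
  classical
  refine ⟨fun {k γ} hγ => ?_⟩
  obtain ⟨φ, hφ⟩ := (hR.of_adm (adm_snoc hγ)).majority_snoc
  refine ⟨φ, fun e => (hφ e).trans ?_⟩
  simp only [Assignment.init_snoc, Assignment.last_snoc, last_eq hγ, Finset.card_filter,
    Finset.sum_range]

theorem sat {n : ℕ} (φ : Formula α n) {g : Fin n → E → ℕ} (hg : ∀ i, IsPosition (g i)) :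
    Definable fun e => φ.Sat (str e).1 fun i => g i e + 1 := by
  refine ⟨fun hγ => ?_⟩
  simp only [str_eq hγ]
  exact .sat φ fun i => (hg i).of_adm hγ

theorem token (a : α) : Definable fun p : Pos E => (str p.1).1.2 p.2 = a := by
  refine (sat (n := 1) (.token a (.var 0)) (g := fun _ (p : Pos E) => (p.2 : ℕ))
    fun _ => IsPosition.snd).congr fun p => ?_
  simp only [Formula.Sat, Term.eval, Nat.cast_add, Nat.cast_one, add_left_inj, Nat.cast_inj]
  exact ⟨fun ⟨x, hx, h⟩ => (Fin.ext hx : p.2 = x) ▸ h, fun h => ⟨p.2, rfl, h⟩⟩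

end Definable

/-- The values of an index term whose variables are definable positions. -/
def IsTerm (f : E → ℕ) : Prop :=
  ∃ (n : ℕ) (g : Fin n → E → ℕ) (t : Term n),
    (∀ i, IsPosition (g i)) ∧ ∀ e, t.eval (last e + 1) (fun i => g i e + 1) = f e

namespace IsTerm

variable {f g : E → ℕ}

theorem one : IsTerm fun _ : E => 1 := ⟨0, Fin.elim0, .one, fun i => i.elim0, fun _ => rfl⟩

theorem zero : IsTerm fun _ : E => 0 :=
  ⟨0, Fin.elim0, .sub .one .one, fun i => i.elim0, fun _ => rfl⟩

theorem last : IsTerm (last : E → ℕ) :=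
  ⟨0, Fin.elim0, .sub .len .one, fun i => i.elim0, fun _ => by simp [Term.eval]⟩

theorem exists_pair (hf : IsTerm f) (hg : IsTerm g) :
    ∃ (n : ℕ) (x : Fin n → E → ℕ) (s t : Term n), (∀ i, IsPosition (x i)) ∧
      (∀ e, s.eval (FOM.last e + 1) (fun i => x i e + 1) = f e) ∧
      ∀ e, t.eval (FOM.last e + 1) (fun i => x i e + 1) = g e := by
  obtain ⟨n, x, s, hx, hs⟩ := hf
  obtain ⟨m, y, t, hy, ht⟩ := hg
  refine ⟨n + m, Fin.append x y, s.rename (Fin.castAdd m), t.rename (Fin.natAdd n), ?_, ?_, ?_⟩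
  · exact Fin.addCases (by simpa using hx) (by simpa using hy)
  · simpa [Term.eval_rename, Function.comp_def] using hs
  · simpa [Term.eval_rename, Function.comp_def] using ht

theorem add (hf : IsTerm f) (hg : IsTerm g) : IsTerm fun e => f e + g e := by
  obtain ⟨n, x, s, t, hx, hs, ht⟩ := hf.exists_pair hg
  exact ⟨n, x, .add s t, hx, fun e => by simp only [Term.eval, hs, ht, Nat.cast_add]⟩

theorem succ (hf : IsTerm f) : IsTerm fun e => f e + 1 := hf.add one

theorem nsmul (hf : IsTerm f) : ∀ c : ℕ, IsTerm fun e => c * f e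
  | 0 => by simpa using zero
  | c + 1 => by simpa only [Nat.add_one_mul] using (hf.nsmul c).add hf

theorem comp {f : E' → ℕ} (hf : IsTerm f) {g : E → E'} (hg : DefinableMap g) :
    IsTerm fun e => f (g e) := by
  obtain ⟨n, x, t, hx, ht⟩ := hf
  refine ⟨n, fun i e => x i (g e), t, fun i => (hx i).comp hg, fun e => ?_⟩
  rw [← ht, hg.last_eq]

theorem le (hf : IsTerm f) (hg : IsTerm g) : Definable fun e => f e ≤ g e := by
  obtain ⟨n, x, s, t, hx, hs, ht⟩ := hf.exists_pair hg
  refine (Definable.sat (.le s t) hx).congr fun e => ?_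
  rw [← Nat.cast_le (α := ℤ), ← hs, ← ht]
  rfl

theorem lt (hf : IsTerm f) (hg : IsTerm g) : Definable fun e => f e < g e := hf.succ.le hg

theorem eq (hf : IsTerm f) (hg : IsTerm g) : Definable fun e => f e = g e :=
  ((hf.le hg).and (hg.le hf)).congr fun _ => le_antisymm_iff.symm

theorem testBit (hf : IsTerm f) (hg : IsTerm g) :
    Definable fun e => (f e).testBit (g e) = true := by
  obtain ⟨n, x, s, t, hx, hs, ht⟩ := hf.exists_pair hg
  refine (Definable.sat (.bit s t) hx).congr fun e => ?_
  have hs' : s.eval ((str e).1.1 + 1) (fun i => x i e + 1) = f e := hs e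
  have ht' : t.eval ((str e).1.1 + 1) (fun i => x i e + 1) = g e := ht e
  simp [Formula.Sat, hs', ht']

end IsTerm

theorem IsPosition.isTerm {f : E → ℕ} (hf : IsPosition f) : IsTerm f :=
  ⟨1, fun _ => f, .sub (.var 0) .one, fun _ => hf, fun _ => by simp [Term.eval]⟩

theorem Definable.const (P : Prop) : Definable fun _ : E => P := by
  by_cases h : P
  · exact (IsTerm.zero.eq .zero).congr fun _ => by simp [h]
  · exact (IsTerm.zero.eq .one).congr fun _ => by simp [h]

/-! ## Digits -/

/-- The length in bits of the digits that are used for strings with last position `n`. -/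
def shift (n : ℕ) : ℕ := Nat.log 2 (n + 1) / 3

/-- The base in which numbers are represented by tuples of positions. The cube root leaves room
for coding pairs of digits by positions. -/
def base (n : ℕ) : ℕ := 2 ^ shift n

/-- The `j`-th digit of `x` in base `base n`. -/
def digit (n j x : ℕ) : ℕ := x / base n ^ j % base n

section Base

variable {n : ℕ}

theorem base_pos (n : ℕ) : 0 < base n := by unfold base; positivity

theorem one_le_shift (hn : 7 ≤ n) : 1 ≤ shift n := by
  have : 3 ≤ Nat.log 2 (n + 1) := Nat.le_log_of_pow_le (by norm_num) (by omega)
  unfold shift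
  omega

theorem two_le_base (hn : 7 ≤ n) : 2 ≤ base n :=
  Nat.pow_le_pow_right (n := 2) (by norm_num) (one_le_shift hn)

theorem base_pow_three_le (n : ℕ) : base n ^ 3 ≤ n + 1 := by
  rw [base, ← pow_mul]
  calc 2 ^ (shift n * 3) ≤ 2 ^ Nat.log 2 (n + 1) :=
        Nat.pow_le_pow_right (by norm_num) (Nat.div_mul_le_self _ _)
    _ ≤ n + 1 := Nat.pow_log_le_self _ (by omega)

theorem two_mul_base_sq_le (hn : 7 ≤ n) : 2 * base n ^ 2 ≤ n + 1 := by
  have := base_pow_three_le n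
  have := two_le_base hn
  nlinarith [sq_nonneg (base n)]

theorem base_le (hn : 7 ≤ n) : base n ≤ n := by
  have := two_mul_base_sq_le hn
  have := two_le_base hn
  nlinarith

theorem digit_lt (n j x : ℕ) : digit n j x < base n := Nat.mod_lt _ (base_pos n)

theorem digit_le (hn : 7 ≤ n) (j x : ℕ) : digit n j x ≤ n := (digit_lt n j x).le.trans (base_le hn)

theorem lt_base_pow_six (hn : 7 ≤ n) : n < base n ^ 6 := by
  have hlog : Nat.log 2 (n + 1) + 1 ≤ shift n * 6 := by
    have := one_le_shift hn
    unfold shift at *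
    omega
  calc n < n + 1 := n.lt_succ_self
    _ < 2 ^ (Nat.log 2 (n + 1) + 1) := Nat.lt_pow_succ_log_self (by norm_num) _
    _ ≤ 2 ^ (shift n * 6) := Nat.pow_le_pow_right (by norm_num) hlog
    _ = base n ^ 6 := by rw [base, ← pow_mul]

end Base

theorem testBit_eq_false_of_le_of_lt {x t n : ℕ} (hx : x ≤ n) (ht : n < t) :
    x.testBit t = false :=
  Nat.testBit_lt_two_pow <| (hx.trans_lt ht).trans Nat.lt_two_pow_self

theorem testBit_digit (n j x t : ℕ) :
    (digit n j x).testBit t = true ↔ t < shift n ∧ x.testBit (j * shift n + t) = true := by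
  rw [digit, base, ← pow_mul, Nat.testBit_mod_two_pow, Nat.testBit_div_two_pow, mul_comm, add_comm]
  simp

theorem testBit_log_self {n : ℕ} (hn : n ≠ 0) : n.testBit (Nat.log 2 n) = true :=
  Nat.log2_eq_log_two ▸ Nat.testBit_log2 hn

theorem log_two_eq_iff {n k : ℕ} (hn : n ≠ 0) :
    Nat.log 2 n = k ↔ n.testBit k = true ∧ ∀ t < n, n.testBit t = true → t ≤ k := by
  have le_log : ∀ t, n.testBit t = true → t ≤ Nat.log 2 n := fun t ht =>
    Nat.le_log_of_pow_le (by norm_num) (Nat.ge_two_pow_of_testBit ht)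
  constructor
  · rintro rfl
    exact ⟨testBit_log_self hn, fun t _ => le_log t⟩
  · rintro ⟨hk, hle⟩
    exact le_antisymm (hle _ (Nat.log_lt_self 2 hn) (testBit_log_self hn)) (le_log k hk)

namespace IsPosition

theorem log : IsPosition fun e : E => Nat.log 2 (last e + 1) := by
  refine of_graph (fun e => Nat.le_of_lt_succ (Nat.log_lt_self 2 (by omega))) ?_
  refine (((IsTerm.last.succ.testBit snd.isTerm).and <|
    Definable.forall_le (R := fun (p : Pos E) t => (last p + 1).testBit t = true → t ≤ p.2)
      ((IsTerm.last.succ.testBit snd.isTerm).imp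
        (snd.isTerm.le (snd.isTerm.comp .pos_fst)))).congr fun p => ?_)
  simp only [log_two_eq_iff (Nat.succ_ne_zero _), Nat.lt_succ_iff]
  rfl

theorem shift : IsPosition fun e : E => shift (last e) := by
  refine of_graph (fun e => ?_) ?_
  · exact (Nat.div_le_self _ _).trans (Nat.le_of_lt_succ (Nat.log_lt_self 2 (by omega)))
  have hlog := (log (E := E)).isTerm.comp (DefinableMap.pos_fst (E := E))
  refine (((snd.isTerm.nsmul 3).le hlog).and
    (hlog.lt ((snd.isTerm.nsmul 3).add (IsTerm.one.nsmul 3)))).congr fun p => ?_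
  unfold FOM.shift
  omega

theorem of_testBit {f : E → ℕ} (hle : ∀ e, f e ≤ last e)
    (hf : Definable fun p : Pos E => (f p.1).testBit p.2 = true) : IsPosition f := by
  refine of_graph hle ?_
  refine (Definable.forall_le (E := Pos E)
    (R := fun p t => ((f p.1).testBit t = true ↔ (p.2 : ℕ).testBit t = true)) ?_).congr fun p => ?_
  · exact (hf.comp (.pos (.comp .pos_fst .pos_fst) snd)).iff
      ((snd.isTerm.comp .pos_fst).testBit snd.isTerm)
  · refine ⟨fun h => Nat.eq_of_testBit_eq fun t => ?_, fun h t _ => by rw [h]⟩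
    rcases le_or_gt t (last p) with ht | ht
    · exact Bool.eq_iff_iff.2 (h t ht)
    · rw [testBit_eq_false_of_le_of_lt (hle _) ht,
        testBit_eq_false_of_le_of_lt (Nat.lt_succ_iff.1 p.2.2) ht]

theorem of_isTerm {f : E → ℕ} (hf : IsTerm f) (hle : ∀ e, f e ≤ last e) : IsPosition f :=
  of_graph hle ((hf.comp .pos_fst).eq snd.isTerm)

theorem two_pow {f : E → ℕ} (hf : IsTerm f) (hle : ∀ e, 2 ^ f e ≤ last e) :
    IsPosition fun e => 2 ^ f e := by
  refine of_testBit hle (((hf.comp .pos_fst).eq snd.isTerm).congr fun p => ?_)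
  rw [Nat.testBit_two_pow, decide_eq_true_iff]

theorem base_sq : IsPosition fun e : E => base (last e) ^ 2 := by
  simp only [FOM.base, ← pow_mul, mul_comm _ 2]
  refine two_pow (shift.isTerm.nsmul 2) fun e => ?_
  rw [mul_comm, pow_mul]
  have := two_mul_base_sq_le (seven_le_last e)
  have := two_le_base (seven_le_last e)
  unfold FOM.base at *
  nlinarith

theorem half : IsPosition fun e : E => (last e + 1) / 2 := by
  refine of_graph (fun e => by have := seven_le_last e; omega) ?_
  refine (((snd.isTerm.nsmul 2).le (IsTerm.last.comp .pos_fst).succ).and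
    ((IsTerm.last.comp .pos_fst).lt (snd.isTerm.nsmul 2).succ)).congr fun p => ?_
  omega

theorem of_le {f : E → ℕ} (hle : ∀ e, f e ≤ last e)
    (hf : Definable fun p : Pos E => (p.2 : ℕ) ≤ f p.1)
    (hf' : Definable fun p : Pos E => (p.2 : ℕ) + 1 ≤ f p.1) : IsPosition f :=
  of_graph hle <| (hf.and hf'.not).congr fun p => by omega

end IsPosition

theorem IsTerm.digit {f : E → ℕ} (hf : IsTerm f) (j : ℕ) :
    IsPosition fun e => FOM.digit (FOM.last e) j (f e) := by
  refine IsPosition.of_testBit (fun e => digit_le (seven_le_last e) _ _) ?_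
  have hshift := (IsPosition.shift (E := E)).isTerm.comp (DefinableMap.pos_fst (E := E))
  refine ((IsPosition.snd.isTerm.lt hshift).and
    ((hf.comp .pos_fst).testBit ((hshift.nsmul j).add IsPosition.snd.isTerm))).congr fun p =>
      (testBit_digit _ _ _ _).symm

/-- Padding of the lower half of the positions by an interval in the upper half turns a
comparison of a cardinality with `y` into a majority. -/
theorem le_card_filter_iff_lt_two_mul_card (R : ℕ → Prop) [DecidablePred R] {m y : ℕ}
    (hy : 1 ≤ y) :
    y ≤ ((Finset.range (m / 2)).filter R).card ↔
      m < 2 * ((Finset.range m).filter fun x =>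
        x < m / 2 ∧ R x ∨ m / 2 ≤ x ∧ x + y ≤ 2 * (m / 2)).card := by
  have filter_eq : ((Finset.range m).filter fun x =>
      x < m / 2 ∧ R x ∨ m / 2 ≤ x ∧ x + y ≤ 2 * (m / 2)) =
      (Finset.range (m / 2)).filter R ∪ Finset.Ico (m / 2) (2 * (m / 2) + 1 - y) := by
    grind
  have disjoint : Disjoint ((Finset.range (m / 2)).filter R)
      (Finset.Ico (m / 2) (2 * (m / 2) + 1 - y)) := by
    rw [Finset.disjoint_left]
    grind
  have card_le : ((Finset.range (m / 2)).filter R).card ≤ m / 2 :=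
    (Finset.card_filter_le _ _).trans (by simp)
  rw [filter_eq, Finset.card_union_of_disjoint disjoint, Nat.card_Ico]
  omega

section Counting

variable {R : E → ℕ → Prop} [∀ e, DecidablePred (R e)]

theorem Definable.le_card_filter (hR : Definable fun p : Pos E => R p.1 p.2) {f : E → ℕ}
    (hf : IsTerm f) :
    Definable fun e => f e ≤ ((Finset.range ((last e + 1) / 2)).filter (R e)).card := by
  have hmaj : Definable fun e : E => last e + 1 < 2 * ((Finset.range (last e + 1)).filter fun x =>
      x < (last e + 1) / 2 ∧ R e x ∨
        (last e + 1) / 2 ≤ x ∧ x + f e ≤ 2 * ((last e + 1) / 2)).card := by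
    have hhalf := (IsPosition.half (E := E)).isTerm.comp (DefinableMap.pos_fst (E := E))
    have hsnd := (IsPosition.snd (E := E)).isTerm
    exact majority (((hsnd.lt hhalf).and hR).or
      ((hhalf.le hsnd).and ((hsnd.add (hf.comp .pos_fst)).le (hhalf.nsmul 2))))
  refine ((hf.eq .zero).or hmaj).congr fun e => ?_
  rcases Nat.eq_zero_or_pos (f e) with h | h
  · simp [h]
  · simp [h.ne', le_card_filter_iff_lt_two_mul_card (R e) h]

theorem IsPosition.card_filter (hR : Definable fun p : Pos E => R p.1 p.2) :
    IsPosition fun e => ((Finset.range ((last e + 1) / 2)).filter (R e)).card := by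
  refine .of_le (fun e => (Finset.card_filter_le _ _).trans (by simp; omega)) ?_ ?_
  all_goals
    refine Definable.le_card_filter (E := Pos E) (R := fun p => R p.1)
      (hR.comp (.pos (.comp .pos_fst .pos_fst) IsPosition.snd)) ?_
  · exact snd.isTerm
  · exact snd.isTerm.succ

end Counting

/-! ## Feasible numbers -/

/-- A number of polynomial size whose digits are definable positions. -/
structure DigitDefinable (f : Assignment α k → ℕ) : Prop where
  bounded : ∃ c, ∀ e, f e < base e.str.1.1 ^ c
  digit : ∀ j, PositionDefinable fun e => digit e.str.1.1 j (f e)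

theorem DigitDefinable.init {f : Assignment α k → ℕ} (hf : DigitDefinable f) :
    DigitDefinable fun e : Assignment α (k + 1) => f e.init :=
  ⟨hf.bounded.imp fun _ h e => h e.init, fun j => (hf.digit j).init⟩

instance : Context α (E × ℕ) where
  str p := str p.1
  Adm γ := Adm (fun e => (γ e).1) ∧ DigitDefinable fun e => (γ e).2
  str_eq h := str_eq h.1
  init h := ⟨init h.1, h.2.init⟩

/-- A number that depends on an environment, has polynomial size and definable digits: these
numbers can be computed within the logic. -/
structure Feasible (f : E → ℕ) : Prop where
  bounded : ∀ {k : ℕ} {γ : Assignment α k → E}, Adm γ → ∃ c, ∀ e, f (γ e) < base e.str.1.1 ^ c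
  digit : ∀ j, IsPosition fun e => digit (last e) j (f e)

theorem Feasible.of_adm {f : E → ℕ} (hf : Feasible f) {γ : Assignment α k → E} (hγ : Adm γ) :
    DigitDefinable fun e => f (γ e) :=
  ⟨hf.bounded hγ, fun j => by simpa only [last_eq hγ] using (hf.digit j).of_adm hγ⟩

theorem IsPosition.feasible {f : E → ℕ} (hf : IsPosition f) : Feasible f where
  bounded hγ := ⟨6, fun e => ((hf.of_adm hγ).le e).trans_lt (lt_base_pow_six e.str.2)⟩
  digit := hf.isTerm.digit

namespace DefinableMap

theorem fst : DefinableMap (Prod.fst : E × ℕ → E) := ⟨fun h => h.1, fun _ => rfl⟩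

theorem pair {g : E → E'} {f : E → ℕ} (hg : DefinableMap g) (hf : Feasible f) :
    DefinableMap fun e => (g e, f e) := ⟨fun h => ⟨hg.adm h, hf.of_adm h⟩, hg.str_eq⟩

theorem pos_pair : DefinableMap fun p : Pos E => (p.1, (p.2 : ℕ)) :=
  pos_fst.pair IsPosition.snd.feasible

end DefinableMap

section Arithmetic

/-- The carry into the `j`-th digit in the addition of `x` and `y` in base `b`. -/
def carry (b j x y : ℕ) : ℕ := (x % b ^ j + y % b ^ j) / b ^ j

variable {b : ℕ}

theorem carry_zero (b x y : ℕ) : carry b 0 x y = 0 := by simp [carry, Nat.mod_one]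

theorem carry_succ (hb : 0 < b) (j x y : ℕ) :
    carry b (j + 1) x y = (x / b ^ j % b + y / b ^ j % b + carry b j x y) / b := by
  have hp : 0 < b ^ j := by positivity
  rw [carry, carry, Nat.mod_pow_succ, Nat.mod_pow_succ, pow_succ, ← Nat.div_div_eq_div_mul]
  congr 1
  rw [show x % b ^ j + b ^ j * (x / b ^ j % b) + (y % b ^ j + b ^ j * (y / b ^ j % b)) =
    b ^ j * (x / b ^ j % b + y / b ^ j % b) + (x % b ^ j + y % b ^ j) by ring,
    Nat.mul_add_div hp]

theorem carry_lt_two (hb : 0 < b) (j x y : ℕ) : carry b j x y < 2 := by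
  have hp : 0 < b ^ j := by positivity
  rw [carry, Nat.div_lt_iff_lt_mul hp]
  have := Nat.mod_lt x hp
  have := Nat.mod_lt y hp
  omega

theorem add_div_pow_mod (hb : 0 < b) (j x y : ℕ) :
    (x + y) / b ^ j % b = (x / b ^ j % b + y / b ^ j % b + carry b j x y) % b := by
  have hp : 0 < b ^ j := by positivity
  have add_div : (x + y) / b ^ j = x / b ^ j + y / b ^ j + carry b j x y := by
    rw [carry, ← Nat.mul_add_div hp]
    congr 1
    conv_lhs => rw [← Nat.div_add_mod x (b ^ j), ← Nat.div_add_mod y (b ^ j)]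
    ring
  simp only [add_div, Nat.add_mod, Nat.mod_mod]

theorem mod_pow_succ_le_iff (hb : 0 < b) (j x y : ℕ) :
    x % b ^ (j + 1) ≤ y % b ^ (j + 1) ↔ x / b ^ j % b < y / b ^ j % b ∨
      x / b ^ j % b = y / b ^ j % b ∧ x % b ^ j ≤ y % b ^ j := by
  have hp : 0 < b ^ j := by positivity
  rw [Nat.mod_pow_succ, Nat.mod_pow_succ]
  have hx := Nat.mod_lt x hp
  have hy := Nat.mod_lt y hp
  generalize x % b ^ j = r, y % b ^ j = s at *
  rcases lt_trichotomy (x / b ^ j % b) (y / b ^ j % b) with h | h | h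
  · simp only [h, true_or, iff_true]
    have := Nat.mul_le_mul_left (b ^ j) (Nat.succ_le_of_lt h)
    rw [Nat.mul_succ] at this
    omega
  · simp [h]
  · simp only [h.not_gt, h.ne', false_and, or_false, iff_false, not_le]
    have := Nat.mul_le_mul_left (b ^ j) (Nat.succ_le_of_lt h)
    rw [Nat.mul_succ] at this
    omega

theorem pow_mul_div_pow_mod (hb : 0 < b) (i j x : ℕ) :
    b ^ i * x / b ^ j % b = if j < i then 0 else x / b ^ (j - i) % b := by
  split_ifs with h
  · obtain ⟨i, rfl⟩ := Nat.exists_eq_add_of_lt h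
    rw [add_assoc, pow_add, mul_assoc, Nat.mul_div_cancel_left _ (by positivity), pow_succ',
      mul_assoc, Nat.mul_mod_right]
  · obtain ⟨j, rfl⟩ := Nat.exists_eq_add_of_le (not_lt.1 h)
    rw [Nat.add_sub_cancel_left, pow_add, Nat.mul_div_mul_left _ _ (by positivity)]

theorem sum_pow_mul_digit (b x c : ℕ) :
    ∑ j ∈ Finset.range c, b ^ j * (x / b ^ j % b) = x % b ^ c := by
  induction c with
  | zero => simp [Nat.mod_one]
  | succ c ih => rw [Finset.sum_range_succ, ih, Nat.mod_pow_succ]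

theorem sum_range_mul {M : Type*} [AddCommMonoid M] (f : ℕ → M) (m n : ℕ) :
    ∑ q ∈ Finset.range (m * n), f q =
      ∑ i ∈ Finset.range n, ∑ j ∈ Finset.range m, f (m * i + j) := by
  induction n with
  | zero => simp
  | succ n ih => rw [Nat.mul_succ, Finset.sum_range_add, ih, Finset.sum_range_succ]

/-- The pairs `(y, z)` with `z < d y` are coded by the numbers `b * y + z`. -/
theorem sum_eq_card_filter {d : ℕ → ℕ} (hd : ∀ y, d y < b) {h : ℕ} (hh : b ^ 2 ≤ h) :
    ∑ y ∈ Finset.range b, d y =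
      ((Finset.range h).filter fun q => q < b ^ 2 ∧ q % b < d (q / b)).card := by
  have filter_eq : ((Finset.range h).filter fun q => q < b ^ 2 ∧ q % b < d (q / b)) =
      (Finset.range (b * b)).filter fun q => q % b < d (q / b) := by
    ext q
    simp only [Finset.mem_filter, Finset.mem_range, ← pow_two]
    exact ⟨fun h => h.2, fun h => ⟨h.1.trans_le hh, h⟩⟩
  rw [filter_eq, Finset.card_filter, sum_range_mul]
  refine Finset.sum_congr rfl fun y _ => ?_
  have decode : ∀ z ∈ Finset.range b, (if (b * y + z) % b < d ((b * y + z) / b) then 1 else 0) =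
      if z < d y then 1 else 0 := by
    intro z hz
    rw [Finset.mem_range] at hz
    rw [Nat.mul_add_mod, Nat.mod_eq_of_lt hz, Nat.mul_add_div (by omega), Nat.div_eq_of_lt hz,
      add_zero]
  rw [Finset.sum_congr rfl decode, ← Finset.card_filter, Finset.filter_congr_decidable]
  have : (Finset.range b).filter (· < d y) = Finset.range (d y) := by
    ext z
    simp only [Finset.mem_filter, Finset.mem_range]
    exact ⟨fun h => h.2, fun h => ⟨h.trans (hd y), h⟩⟩
  rw [this, Finset.card_range]

end Arithmetic

theorem lt_base_pow_max_left (n : ℕ) {x c : ℕ} (hx : x < base n ^ c) (d : ℕ) :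
    x < base n ^ max c d :=
  hx.trans_le (Nat.pow_le_pow_right (base_pos n) (le_max_left c d))

theorem lt_base_pow_max_right (n : ℕ) {x d : ℕ} (hx : x < base n ^ d) (c : ℕ) :
    x < base n ^ max c d := max_comm d c ▸ lt_base_pow_max_left n hx c

namespace Feasible

variable {f g : E → ℕ}

theorem exists_lt (hf : Feasible f) (hg : Feasible g) {γ : Assignment α k → E} (hγ : Adm γ) :
    ∃ c, ∀ e, f (γ e) < base e.str.1.1 ^ c ∧ g (γ e) < base e.str.1.1 ^ c := by
  obtain ⟨c, hc⟩ := hf.bounded hγ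
  obtain ⟨d, hd⟩ := hg.bounded hγ
  exact ⟨max c d, fun e => ⟨lt_base_pow_max_left _ (hc e) d, lt_base_pow_max_right _ (hd e) c⟩⟩

theorem comp {f : E' → ℕ} (hf : Feasible f) {g : E → E'} (hg : DefinableMap g) :
    Feasible fun e => f (g e) where
  bounded hγ := hf.bounded (hg.adm hγ)
  digit j := by simpa only [hg.last_eq] using (hf.digit j).comp hg

theorem of_locally (h : ∀ {k : ℕ} {γ : Assignment α k → E}, Adm γ →
    ∃ g : E → ℕ, Feasible g ∧ ∀ e, f (γ e) = g (γ e)) : Feasible f where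
  bounded hγ := by
    obtain ⟨g, hg, hfg⟩ := h hγ
    simpa only [hfg] using hg.bounded hγ
  digit j := ⟨fun hγ => by
    obtain ⟨g, hg, hfg⟩ := h hγ
    simpa only [hfg] using (hg.digit j).of_adm hγ⟩

theorem last : Feasible (last : E → ℕ) := (IsPosition.of_isTerm .last fun _ => le_rfl).feasible

theorem isTerm_carry (hf : Feasible f) (hg : Feasible g) :
    ∀ j, IsTerm fun e => carry (base (FOM.last e)) j (f e) (g e)
  | 0 => by simpa only [carry_zero] using IsTerm.zero
  | j + 1 => by
    have hsum := (((hf.digit j).isTerm.add (hg.digit j).isTerm).add (isTerm_carry hf hg j)).digit 1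
    simp only [FOM.digit, pow_one] at hsum
    convert hsum.isTerm with e
    have two_le := two_le_base (seven_le_last e)
    generalize base (FOM.last e) = b at *
    have hb : 0 < b := by omega
    have := Nat.mod_lt (f e / b ^ j) hb
    have := Nat.mod_lt (g e / b ^ j) hb
    have := carry_lt_two hb j (f e) (g e)
    rw [carry_succ hb]
    refine (Nat.mod_eq_of_lt ((Nat.div_lt_iff_lt_mul hb).2 ?_)).symm
    nlinarith

theorem add (hf : Feasible f) (hg : Feasible g) : Feasible fun e => f e + g e where
  bounded hγ := by
    obtain ⟨c, hc⟩ := hf.exists_lt hg hγ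
    refine ⟨c + 1, fun e => ?_⟩
    have := two_le_base e.str.2
    rw [pow_succ]
    nlinarith [hc e]
  digit j := by
    have := (((hf.digit j).isTerm.add (hg.digit j).isTerm).add (hf.isTerm_carry hg j)).digit 0
    simp only [FOM.digit, pow_zero, Nat.div_one] at this
    simpa only [FOM.digit, add_div_pow_mod (base_pos _)] using this

theorem const : ∀ c : ℕ, Feasible fun _ : E => c
  | 0 => (IsPosition.of_isTerm .zero fun _ => Nat.zero_le _).feasible
  | c + 1 => (const c).add
      (IsPosition.of_isTerm .one fun e => by have := seven_le_last e; omega).feasible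

theorem definable_mod_base_pow_le (hf : Feasible f) (hg : Feasible g) :
    ∀ j, Definable fun e => f e % base (FOM.last e) ^ j ≤ g e % base (FOM.last e) ^ j
  | 0 => (Definable.const True).congr fun e => by simp [Nat.mod_one]
  | j + 1 => by
    simp only [mod_pow_succ_le_iff (base_pos _)]
    have hf' := (hf.digit j).isTerm
    have hg' := (hg.digit j).isTerm
    exact (hf'.lt hg').or ((hf'.eq hg').and (definable_mod_base_pow_le hf hg j))

theorem le (hf : Feasible f) (hg : Feasible g) : Definable fun e => f e ≤ g e := by
  refine ⟨fun {k γ} hγ => ?_⟩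
  obtain ⟨c, hc⟩ := hf.exists_lt hg hγ
  convert (hf.definable_mod_base_pow_le hg c).of_adm hγ using 3 with e
  all_goals rw [last_eq hγ, Nat.mod_eq_of_lt]
  exacts [(hc e).1, (hc e).2]

theorem lt (hf : Feasible f) (hg : Feasible g) : Definable fun e => f e < g e :=
  (hg.le hf).not.congr fun _ => not_le

theorem eq (hf : Feasible f) (hg : Feasible g) : Definable fun e => f e = g e :=
  ((hf.le hg).and (hg.le hf)).congr fun _ => le_antisymm_iff.symm

theorem ite {R : E → Prop} [DecidablePred R] (hR : Definable R) (hf : Feasible f)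
    (hg : Feasible g) : Feasible fun e => if R e then f e else g e where
  bounded hγ := by
    obtain ⟨c, hc⟩ := hf.exists_lt hg hγ
    refine ⟨c, fun e => ?_⟩
    split_ifs
    exacts [(hc e).1, (hc e).2]
  digit j := by
    refine .of_graph (fun e => digit_le (seven_le_last e) _ _) ?_
    refine (((hR.comp .pos_fst).and (hf.digit j).graph).or
      ((hR.comp .pos_fst).not.and (hg.digit j).graph)).congr fun p => ?_
    by_cases h : R p.1 <;> simp [h]

theorem isPosition (hf : Feasible f) (hle : ∀ e, f e ≤ FOM.last e) : IsPosition f :=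
  .of_graph hle ((hf.comp .pos_fst).eq IsPosition.snd.feasible)

theorem fst (hf : Feasible f) : Feasible fun p : E × ℕ => f p.1 := hf.comp .fst

theorem snd : Feasible fun p : E × ℕ => p.2 where
  bounded hγ := hγ.2.bounded
  digit j := ⟨fun {k γ} hγ => by
    simpa only [last_eq hγ] using hγ.2.digit j⟩

theorem base_pow_mul (hf : Feasible f) (i : ℕ) : Feasible fun e => base (FOM.last e) ^ i * f e where
  bounded {k γ} hγ := by
    obtain ⟨c, hc⟩ := hf.bounded hγ
    refine ⟨i + c, fun e => ?_⟩
    rw [pow_add, last_eq hγ]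
    exact Nat.mul_lt_mul_of_pos_left (hc e) (pow_pos (base_pos _) i)
  digit j := by
    simp only [FOM.digit, pow_mul_div_pow_mod (base_pos _)]
    split_ifs
    exacts [.of_isTerm .zero fun _ => Nat.zero_le _, hf.digit (j - i)]

theorem sum {ι : Type*} (s : Finset ι) {F : ι → E → ℕ} (hF : ∀ i, Feasible (F i)) :
    Feasible fun e => ∑ i ∈ s, F i e := by
  classical
  induction s using Finset.induction_on with
  | empty => simpa using const 0
  | insert i s hi ih => simpa only [Finset.sum_insert hi] using (hF i).add ih

end Feasible

theorem IsPosition.sum_range_base {d : E → ℕ → ℕ} (hlt : ∀ e y, d e y < FOM.base (last e))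
    (hd : IsPosition fun p : Pos E => d p.1 p.2) :
    IsPosition fun e => ∑ y ∈ Finset.range (FOM.base (last e)), d e y := by
  classical
  let decode (p : Pos E) : Pos E :=
    ⟨p.1, digit (last p) 1 p.2, Nat.lt_succ_of_le (digit_le (seven_le_last p) _ _)⟩
  have hdecode : DefinableMap decode := .pos .pos_fst (IsPosition.snd.isTerm.digit 1)
  have hR : Definable fun p : Pos E => (p.2 : ℕ) < FOM.base (last p.1) ^ 2 ∧
      p.2 % FOM.base (last p.1) < d p.1 (p.2 / FOM.base (last p.1)) := by
    refine ((snd.isTerm.lt (base_sq.isTerm.comp .pos_fst)).and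
      ((snd.isTerm.digit 0).isTerm.lt (hd.comp hdecode).isTerm)).congr fun p => ?_
    refine and_congr_right fun hq => ?_
    have hdiv : (p.2 : ℕ) / FOM.base (last p.1) < FOM.base (last p.1) :=
      Nat.div_lt_of_lt_mul (by rwa [← pow_two])
    have hsnd : ((decode p).2 : ℕ) = p.2 / FOM.base (last p.1) := by
      change digit (last p.1) 1 p.2 = _
      rw [digit, pow_one, Nat.mod_eq_of_lt hdiv]
    rw [hsnd]
    simp only [digit, pow_zero, Nat.div_one]
    rfl
  convert card_filter (R := fun e q => q < FOM.base (last e) ^ 2 ∧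
    q % FOM.base (last e) < d e (q / FOM.base (last e))) hR with e
  refine sum_eq_card_filter (hlt e) ?_
  have := two_mul_base_sq_le (seven_le_last e)
  omega

namespace Feasible

variable {f g : E → ℕ}

theorem sum_range_base {F : E → ℕ → ℕ} (hF : Feasible fun p : E × ℕ => F p.1 p.2) :
    Feasible fun e => ∑ y ∈ Finset.range (base (FOM.last e)), F e y := by
  refine of_locally fun {k γ} hγ => ?_
  have hpos : Feasible fun p : Pos E => F p.1 p.2 := hF.comp .pos_pair
  obtain ⟨c, hc⟩ := hpos.bounded (adm_snoc hγ)
  refine ⟨_, sum (Finset.range c) fun j => (IsPosition.sum_range_base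
    (d := fun e y => FOM.digit (FOM.last e) j (F e y)) (fun e y => digit_lt _ _ _)
      (hpos.digit j)).feasible.base_pow_mul j, fun e => ?_⟩
  simp only [Finset.mul_sum]
  rw [Finset.sum_comm]
  refine Finset.sum_congr rfl fun y hy => ?_
  have hlast := last_eq hγ e
  have hy' : y < e.str.1.1 + 1 := by
    have := base_le e.str.2
    rw [Finset.mem_range, hlast] at hy
    omega
  have hlt := hc (e.snoc ⟨y, hy'⟩)
  simp only [Assignment.init_snoc, Assignment.last_snoc] at hlt
  simp only [FOM.digit, sum_pow_mul_digit]
  rw [hlast]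
  exact (Nat.mod_eq_of_lt hlt).symm

theorem sum_range_base_pow {E : Type u} [Context α E] {F : E → ℕ → ℕ}
    (hF : Feasible fun p : E × ℕ => F p.1 p.2) (c : ℕ) :
    Feasible fun e => ∑ y ∈ Finset.range (base (FOM.last e) ^ c), F e y := by
  induction c generalizing E with
  | zero => simpa using hF.comp (DefinableMap.id.pair (const 0))
  | succ c ih =>
    simp only [pow_succ, sum_range_mul]
    refine sum_range_base (F := fun e z => ∑ y ∈ Finset.range (base (FOM.last e) ^ c),
      F e (base (FOM.last e) ^ c * z + y)) ?_
    refine ih (F := fun (p : E × ℕ) y => F p.1 (base (FOM.last p.1) ^ c * p.2 + y)) ?_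
    exact hF.comp (.pair (.comp .fst .fst) ((snd.base_pow_mul c).fst.add snd))

theorem sum_range {F : E → ℕ → ℕ} (hf : Feasible f) (hF : Feasible fun p : E × ℕ => F p.1 p.2) :
    Feasible fun e => ∑ y ∈ Finset.range (f e), F e y := by
  refine of_locally fun {k γ} hγ => ?_
  obtain ⟨c, hc⟩ := hf.bounded hγ
  refine ⟨_, sum_range_base_pow (F := fun e y => if y < f e then F e y else 0)
    (ite (snd.lt hf.fst) hF (const 0)) c, fun e => ?_⟩
  rw [← Finset.sum_filter, last_eq hγ]
  refine Finset.sum_congr ?_ fun _ _ => rfl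
  ext y
  have := hc e
  simp only [Finset.mem_filter, Finset.mem_range]
  omega

theorem mul (hf : Feasible f) (hg : Feasible g) : Feasible fun e => f e * g e := by
  simpa using hf.sum_range (F := fun e _ => g e) hg.fst

theorem sub (hf : Feasible f) (hg : Feasible g) : Feasible fun e => f e - g e := by
  have h := hf.sum_range (F := fun e y => if g e ≤ y then 1 else 0)
    (ite (hg.fst.le snd) (const 1) (const 0))
  convert h with e
  rw [← Finset.card_filter, ← Nat.card_Ico]
  congr 1
  ext y
  simp only [Finset.mem_filter, Finset.mem_range, Finset.mem_Ico, and_comm]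

theorem pow (hf : Feasible f) (c : ℕ) : Feasible fun e => f e ^ c := by
  induction c with
  | zero => simpa using const 1
  | succ c ih => simpa only [pow_succ] using ih.mul hf

end Feasible

namespace Definable

theorem exists_lt {R : E → ℕ → Prop} {f : E → ℕ} (hf : Feasible f)
    (hR : Definable fun p : E × ℕ => R p.1 p.2) : Definable fun e => ∃ y < f e, R e y := by
  classical
  refine ((Feasible.const 0).lt (hf.sum_range (F := fun e y => if R e y then 1 else 0)
    (Feasible.ite hR (.const 1) (.const 0)))).congr fun e => ?_
  rw [← Finset.card_filter, Finset.card_pos]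
  simp [Finset.Nonempty]

theorem forall_lt {R : E → ℕ → Prop} {f : E → ℕ} (hf : Feasible f)
    (hR : Definable fun p : E × ℕ => R p.1 p.2) : Definable fun e => ∀ y < f e, R e y :=
  (exists_lt hf (R := fun e y => ¬ R e y) hR.not).not.congr fun _ => by push Not; rfl

end Definable

namespace Feasible

variable {f : E → ℕ}

theorem of_graph {b : E → ℕ} (hb : Feasible b) (hle : ∀ e, f e ≤ b e)
    (hf : Definable fun p : E × ℕ => f p.1 = p.2) : Feasible f := by
  classical
  convert (hb.add (const 1)).sum_range (F := fun e y => if f e = y then y else 0)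
    (ite hf snd (const 0)) with e
  rw [Finset.sum_ite_eq, if_pos (Finset.mem_range.2 (Nat.lt_succ_of_le (hle e)))]

theorem findGreatest {R : E → ℕ → Prop} [∀ e, DecidablePred (R e)] (hf : Feasible f)
    (hR : Definable fun p : E × ℕ => R p.1 p.2) :
    Feasible fun e => Nat.findGreatest (R e) (f e) := by
  refine of_graph hf (fun e => Nat.findGreatest_le _) ?_
  have hmax : Definable fun p : E × ℕ => ∀ y < f p.1 + 1, p.2 < y → ¬ R p.1 y :=
    Definable.forall_lt (R := fun (p : E × ℕ) y => p.2 < y → ¬ R p.1 y) (hf.fst.add (const 1))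
      ((snd.fst.lt snd).imp (hR.comp (.pair (.comp .fst .fst) snd)).not)
  refine ((snd.le hf.fst).and (((snd.eq (const 0)).not.imp hR).and hmax)).congr fun p => ?_
  rw [Nat.findGreatest_eq_iff]
  simp only [Nat.lt_succ_iff]
  exact and_congr_right' (and_congr_right' ⟨fun h y h1 h2 => h y h2 h1, fun h y h1 h2 => h h2 h1⟩)

theorem of_lowerElementary {m : ℕ} {F : (Fin m → ℕ) → ℕ} (hF : LowerElementary F)
    {E : Type u} [Context α E] {g : Fin m → E → ℕ} (hg : ∀ i, Feasible (g i)) :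
    Feasible fun e => F fun i => g i e := by
  induction hF generalizing E with
  | const c => exact .const c
  | proj i => exact hg i
  | add _ _ ihf ihg => exact (ihf hg).add (ihg hg)
  | sub _ _ ihf ihg => exact (ihf hg).sub (ihg hg)
  | comp _ _ ihf ihg => exact ihf fun i => ihg i hg
  | @bsum m F _ ih =>
    refine ((hg (Fin.last m)).add (.const 1)).sum_range (F := fun e y =>
      F (Fin.snoc (α := fun _ => ℕ) (Fin.init fun i => g i e) y)) ?_
    have snoc_apply : ∀ (p : E × ℕ) i,
        Fin.snoc (α := fun _ => E × ℕ → ℕ) (fun i p => g i.castSucc p.1) Prod.snd i p =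
          Fin.snoc (α := fun _ => ℕ) (Fin.init fun i => g i p.1) p.2 i := fun p i => by
      refine Fin.lastCases ?_ (fun i => ?_) i <;> simp [Fin.init]
    have hsnoc : ∀ i, Feasible (Fin.snoc (α := fun _ => E × ℕ → ℕ)
        (fun i p => g i.castSucc p.1) Prod.snd i) := fun i => by
      refine Fin.lastCases ?_ (fun i => ?_) i
      · simpa using snd
      · simpa using (hg i.castSucc).fst
    simpa only [snoc_apply] using ih hsnoc

end Feasible

theorem isPowerOfTwo_iff (y : ℕ) : (∃ i, y = 2 ^ i) ↔
    0 < y ∧ ¬ ∃ d < y + 1, ∃ e < y + 1, y = (2 * d + 3) * e := by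
  constructor
  · rintro ⟨i, rfl⟩
    refine ⟨by positivity, ?_⟩
    rintro ⟨d, -, e, -, h⟩
    obtain ⟨j, -, hj⟩ := (Nat.dvd_prime_pow Nat.prime_two).1 (Dvd.intro _ h.symm)
    cases j with
    | zero => omega
    | succ j => rw [pow_succ] at hj; omega
  · rintro ⟨hy, h⟩
    refine (Nat.eq_two_pow_or_exists_odd_prime_and_dvd y).resolve_right ?_
    rintro ⟨p, hp, ⟨e, rfl⟩, j, rfl⟩
    have two_le := hp.two_le
    have he : 0 < e := Nat.pos_of_mul_pos_left hy
    refine h ⟨j - 1, ?_, e, ?_, ?_⟩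
    · nlinarith [Nat.sub_le j 1]
    · nlinarith
    · rw [show 2 * (j - 1) + 3 = 2 * j + 1 by omega]

theorem Definable.isPowerOfTwo {f : E → ℕ} (hf : Feasible f) :
    Definable fun e => ∃ i, f e = 2 ^ i := by
  simp only [isPowerOfTwo_iff]
  refine ((Feasible.const 0).lt hf).and (not ?_)
  refine exists_lt (hf.add (.const 1)) (R := fun e d =>
    ∃ y < f e + 1, f e = (2 * d + 3) * y) ?_
  refine exists_lt (hf.fst.add (.const 1)) (R := fun (p : E × ℕ) y =>
    f p.1 = (2 * p.2 + 3) * y) ?_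
  exact hf.fst.fst.eq ((((Feasible.const 2).mul Feasible.snd.fst).add (.const 3)).mul .snd)

theorem two_pow_size_le {n : ℕ} (hn : n ≠ 0) : 2 ^ n.size ≤ 2 * n := by
  have hpos : 0 < n.size := Nat.size_pos.2 (Nat.pos_of_ne_zero hn)
  have := Nat.lt_size.1 (Nat.sub_lt hpos one_pos)
  calc 2 ^ n.size = 2 * 2 ^ (n.size - 1) := by rw [← pow_succ', Nat.sub_add_cancel hpos]
    _ ≤ 2 * n := by omega

theorem two_pow_size_eq_iff {n y : ℕ} (hn : n ≠ 0) :
    2 ^ n.size = y ↔ (∃ i, y = 2 ^ i) ∧ n < y ∧ y ≤ 2 * n := by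
  constructor
  · rintro rfl
    exact ⟨⟨_, rfl⟩, Nat.lt_size_self _, two_pow_size_le hn⟩
  · rintro ⟨⟨i, rfl⟩, hlt, hle⟩
    have size_le : n.size ≤ i := Nat.size_le.2 hlt
    have lt_size : i < n.size + 1 := (Nat.pow_lt_pow_iff_right (a := 2) (by norm_num)).1 <| by
      have := Nat.lt_size_self n
      rw [pow_succ]
      omega
    rw [show n.size = i by omega]

theorem Feasible.two_pow_size : Feasible fun e : E => 2 ^ (FOM.last e + 1).size := by
  have hlen : ∀ {E : Type u} [Context α E], Feasible fun e : E => FOM.last e + 1 :=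
    last.add (const 1)
  refine of_graph ((const 2).mul hlen) (fun e => two_pow_size_le (Nat.succ_ne_zero _)) ?_
  simp only [two_pow_size_eq_iff (Nat.succ_ne_zero _)]
  exact (Definable.isPowerOfTwo snd).and ((hlen.fst.lt snd).and (snd.le ((const 2).mul hlen).fst))

/-- The position numbered by the given number, or the last position if there is none. -/
def clamp (p : E × ℕ) : Pos E := ⟨p.1, min p.2 (last p.1), Nat.lt_succ_of_le (min_le_right _ _)⟩

theorem DefinableMap.clamp : DefinableMap (clamp : E × ℕ → Pos E) := by
  refine .pos .fst (Feasible.isPosition ?_ fun _ => min_le_right _ _)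
  simp only [min_def]
  exact .ite (Feasible.snd.le Feasible.last.fst) .snd Feasible.last.fst

theorem clamp_val (e : E) (j : Fin (last e + 1)) : clamp (e, (j : ℕ)) = ⟨e, j⟩ := by
  simp only [clamp, min_eq_left (Nat.le_of_lt_succ j.2)]

theorem Feasible.sum_fin {F : Pos E → ℕ} (hF : Feasible F)
    {R : ∀ e : E, Fin (FOM.last e + 1) → Prop} [∀ e, DecidablePred (R e)]
    (hR : Definable fun p : Pos E => R p.1 p.2) :
    Feasible fun e => ∑ j ∈ Finset.univ.filter (R e), F ⟨e, j⟩ := by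
  convert (last.add (const 1)).sum_range (F := fun (e : E) y =>
    if R (clamp (e, y)).1 (clamp (e, y)).2 then F (clamp (e, y)) else 0)
    (ite (hR.comp .clamp) (hF.comp .clamp) (const 0)) with e
  rw [Finset.sum_range, Finset.sum_filter]
  exact Finset.sum_congr rfl fun j _ => by rw [clamp_val]

/-! ## Feasible real numbers and rounding -/

/-- The number of bits of precision of a transformer with precision constant `c`. -/
def bitsOf (c : ℕ) (e : E) : ℕ := c * Nat.size (last e + 1)

theorem Feasible.two_pow_bitsOf (c : ℕ) : Feasible fun e : E => 2 ^ bitsOf c e := by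
  simpa only [bitsOf, mul_comm c, pow_mul] using two_pow_size.pow c

/-- A real number that depends on an environment and is an integer multiple of the unit
`2 ^ (-p)` of the precision `p`, the multiple being a difference of feasible numbers. -/
def FeasibleReal (c : ℕ) (f : E → ℝ) : Prop :=
  ∃ P N : E → ℕ, Feasible P ∧ Feasible N ∧ ∀ e, f e = ((P e : ℝ) - N e) / 2 ^ bitsOf c e

/-- A rational number that depends on an environment and whose numerator and denominator are
feasible; such numbers are the exact results of operations, before they are rounded. -/
def FeasibleRat (f : E → ℝ) : Prop :=
  ∃ P N D : E → ℕ, Feasible P ∧ Feasible N ∧ Feasible D ∧ (∀ e, 0 < D e) ∧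
    ∀ e, f e = ((P e : ℝ) - N e) / D e

namespace FeasibleRat

variable {f g : E → ℝ}

theorem const (q : ℚ) : FeasibleRat fun _ : E => (q : ℝ) := by
  refine ⟨fun _ => q.num.toNat, fun _ => (-q.num).toNat, fun _ => q.den, .const _, .const _,
    .const _, fun _ => q.pos, fun _ => ?_⟩
  have num_eq : (q.num : ℝ) = (q.num.toNat : ℝ) - ((-q.num).toNat : ℝ) := by
    exact_mod_cast (Int.toNat_sub_toNat_neg q.num).symm
  beta_reduce
  rw [← num_eq]
  exact_mod_cast (Rat.num_div_den q).symm

theorem natCast {f : E → ℕ} (hf : Feasible f) : FeasibleRat fun e => (f e : ℝ) :=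
  ⟨f, fun _ => 0, fun _ => 1, hf, .const 0, .const 1, fun _ => one_pos, fun _ => by simp⟩

theorem two_pow_bitsOf (c : ℕ) : FeasibleRat fun e : E => (2 : ℝ) ^ bitsOf c e := by
  simpa using natCast (Feasible.two_pow_bitsOf (E := E) c)

theorem neg (hf : FeasibleRat f) : FeasibleRat fun e => -f e := by
  obtain ⟨P, N, D, hP, hN, hD, D_pos, h⟩ := hf
  exact ⟨N, P, D, hN, hP, hD, D_pos, fun e => by beta_reduce; rw [h, ← neg_div, neg_sub]⟩

theorem add (hf : FeasibleRat f) (hg : FeasibleRat g) : FeasibleRat fun e => f e + g e := by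
  obtain ⟨P, N, D, hP, hN, hD, D_pos, h⟩ := hf
  obtain ⟨P', N', D', hP', hN', hD', D'_pos, h'⟩ := hg
  refine ⟨fun e => P e * D' e + P' e * D e, fun e => N e * D' e + N' e * D e,
    fun e => D e * D' e, (hP.mul hD').add (hP'.mul hD), (hN.mul hD').add (hN'.mul hD),
    hD.mul hD', fun e => Nat.mul_pos (D_pos e) (D'_pos e), fun e => ?_⟩
  have hD0 : (D e : ℝ) ≠ 0 := by exact_mod_cast (D_pos e).ne'
  have hD'0 : (D' e : ℝ) ≠ 0 := by exact_mod_cast (D'_pos e).ne'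
  beta_reduce
  rw [h, h']
  push_cast
  field_simp
  ring

theorem sub (hf : FeasibleRat f) (hg : FeasibleRat g) : FeasibleRat fun e => f e - g e := by
  simpa only [sub_eq_add_neg] using hf.add hg.neg

theorem mul (hf : FeasibleRat f) (hg : FeasibleRat g) : FeasibleRat fun e => f e * g e := by
  obtain ⟨P, N, D, hP, hN, hD, D_pos, h⟩ := hf
  obtain ⟨P', N', D', hP', hN', hD', D'_pos, h'⟩ := hg
  refine ⟨fun e => P e * P' e + N e * N' e, fun e => P e * N' e + N e * P' e,
    fun e => D e * D' e, (hP.mul hP').add (hN.mul hN'), (hP.mul hN').add (hN.mul hP'),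
    hD.mul hD', fun e => Nat.mul_pos (D_pos e) (D'_pos e), fun e => ?_⟩
  beta_reduce
  rw [h, h', div_mul_div_comm]
  push_cast
  ring

theorem inv (hf : FeasibleRat f) : FeasibleRat fun e => (f e)⁻¹ := by
  obtain ⟨P, N, D, hP, hN, hD, -, h⟩ := hf
  refine ⟨fun e => if N e < P e then D e else 0, fun e => if P e < N e then D e else 0,
    fun e => if P e = N e then 1 else (P e - N e) + (N e - P e),
    .ite (hN.lt hP) hD (.const 0), .ite (hP.lt hN) hD (.const 0),
    .ite (hP.eq hN) (.const 1) ((hP.sub hN).add (hN.sub hP)), fun e => ?_, fun e => ?_⟩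
  · beta_reduce
    split_ifs <;> omega
  · beta_reduce
    rw [h, inv_div]
    rcases lt_trichotomy (P e) (N e) with hlt | heq | hgt
    · simp only [hlt, hlt.not_gt, hlt.ne, if_false, if_true, Nat.sub_eq_zero_of_le hlt.le, zero_add,
        Nat.cast_sub hlt.le, Nat.cast_zero, zero_sub]
      rw [neg_div, ← div_neg, neg_sub]
    · simp [heq]
    · simp only [hgt, hgt.not_gt, hgt.ne', if_false, if_true, Nat.sub_eq_zero_of_le hgt.le,
        add_zero, Nat.cast_sub hgt.le, Nat.cast_zero, sub_zero]

theorem div (hf : FeasibleRat f) (hg : FeasibleRat g) : FeasibleRat fun e => f e / g e := by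
  simpa only [div_eq_mul_inv] using hf.mul hg.inv

theorem comp {f : E' → ℝ} (hf : FeasibleRat f) {g : E → E'} (hg : DefinableMap g) :
    FeasibleRat fun e => f (g e) := by
  obtain ⟨P, N, D, hP, hN, hD, D_pos, h⟩ := hf
  exact ⟨_, _, _, hP.comp hg, hN.comp hg, hD.comp hg, fun e => D_pos _, fun e => h _⟩

theorem le (hf : FeasibleRat f) (hg : FeasibleRat g) : Definable fun e => f e ≤ g e := by
  obtain ⟨P, N, D, hP, hN, hD, D_pos, h⟩ := hf
  obtain ⟨P', N', D', hP', hN', hD', D'_pos, h'⟩ := hg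
  refine (((hP.mul hD').add (hN'.mul hD)).le ((hP'.mul hD).add (hN.mul hD'))).congr fun e => ?_
  have hD0 : (0 : ℝ) < D e := by exact_mod_cast D_pos e
  have hD'0 : (0 : ℝ) < D' e := by exact_mod_cast D'_pos e
  rw [h, h', div_le_div_iff₀ hD0 hD'0, ← Nat.cast_le (α := ℝ)]
  push_cast
  constructor <;> intro hle <;> linarith

theorem lt (hf : FeasibleRat f) (hg : FeasibleRat g) : Definable fun e => f e < g e :=
  (hg.le hf).not.congr fun _ => not_le

end FeasibleRat

/-- The multiples of the unit `2 ^ (-p)` that are nonnegative floating-point numbers of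
precision `p`. -/
def IsFloat (p q : ℕ) : Prop := ∃ m < 2 ^ p, ∃ Q < 2 ^ p * 2 ^ p + 1, (∃ i, Q = 2 ^ i) ∧ q = m * Q

namespace IsFloat

variable {p q : ℕ}

theorem zero (p : ℕ) : IsFloat p 0 :=
  ⟨0, by positivity, 1, by have := Nat.two_pow_pos p; nlinarith, ⟨0, rfl⟩, by simp⟩

theorem le (h : IsFloat p q) : q ≤ 2 ^ p * (2 ^ p * 2 ^ p) := by
  obtain ⟨m, hm, Q, hQ, -, rfl⟩ := h
  exact Nat.mul_le_mul hm.le (Nat.le_of_lt_succ hQ)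

theorem mem_floats (h : IsFloat p q) : (q : ℝ) / 2 ^ p ∈ floats p := by
  obtain ⟨m, hm, Q, hQ, ⟨i, rfl⟩, rfl⟩ := h
  have hi : i ≤ p + p := by
    rw [← pow_add] at hQ
    exact (Nat.pow_le_pow_iff_right (a := 2) (by norm_num)).1 (Nat.le_of_lt_succ hQ)
  refine ⟨m, (i : ℤ) - p, ?_, ?_, ?_⟩
  · rw [Nat.abs_cast]
    exact_mod_cast hm
  · rw [abs_le]
    omega
  · rw [zpow_sub₀ two_ne_zero, zpow_natCast, zpow_natCast]
    push_cast
    ring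

end IsFloat

theorem exists_isFloat {p : ℕ} {y : ℝ} (hy : y ∈ floats p) (hy0 : 0 ≤ y) :
    ∃ q : ℕ, IsFloat p q ∧ y = q / 2 ^ p := by
  obtain ⟨m, e, hm, he, rfl⟩ := hy
  have hm0 : 0 ≤ m := by
    exact_mod_cast nonneg_of_mul_nonneg_left hy0 (by positivity : (0 : ℝ) < 2 ^ e)
  rw [abs_of_nonneg hm0] at hm
  rw [abs_le] at he
  lift m to ℕ using hm0
  obtain ⟨i, hi⟩ := Int.eq_ofNat_of_zero_le (show 0 ≤ e + p by omega)
  refine ⟨m * 2 ^ i, ⟨m, by exact_mod_cast hm, 2 ^ i, ?_, ⟨i, rfl⟩, rfl⟩, ?_⟩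
  · rw [← pow_add]
    exact Nat.lt_succ_of_le (Nat.pow_le_pow_right two_pos (by omega))
  · rw [show e = (i : ℤ) - p by omega, zpow_sub₀ two_ne_zero, zpow_natCast, zpow_natCast]
    push_cast
    ring

open Classical in
theorem sSup_floats (p : ℕ) {x : ℝ} (hx : 0 ≤ x) :
    sSup {y | y ∈ floats p ∧ y ≤ x} =
      (Nat.findGreatest (fun q => IsFloat p q ∧ (q : ℝ) ≤ x * 2 ^ p)
        (2 ^ p * (2 ^ p * 2 ^ p)) : ℝ) / 2 ^ p := by
  have hU : (0 : ℝ) < 2 ^ p := by positivity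
  have hzero : IsFloat p 0 ∧ ((0 : ℕ) : ℝ) ≤ x * 2 ^ p :=
    ⟨.zero p, by rw [Nat.cast_zero]; positivity⟩
  have hspec := Nat.findGreatest_spec (P := fun q => IsFloat p q ∧ (q : ℝ) ≤ x * 2 ^ p)
    (Nat.zero_le (2 ^ p * (2 ^ p * 2 ^ p))) hzero
  refine IsGreatest.csSup_eq ⟨⟨hspec.1.mem_floats, (div_le_iff₀ hU).2 hspec.2⟩, ?_⟩
  rintro y ⟨hy, hyx⟩
  rcases le_or_gt 0 y with hy0 | hy0
  · obtain ⟨q, hq, rfl⟩ := exists_isFloat hy hy0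
    have := Nat.le_findGreatest (P := fun q => IsFloat p q ∧ (q : ℝ) ≤ x * 2 ^ p) hq.le
      ⟨hq, (div_le_iff₀ hU).1 hyx⟩
    gcongr
  · exact hy0.le.trans (by positivity)

theorem Definable.isFloat (c : ℕ) : Definable fun p : E × ℕ => IsFloat (bitsOf c p.1) p.2 := by
  have hU : ∀ {E : Type u} [Context α E], Feasible fun e : E => 2 ^ bitsOf c e :=
    .two_pow_bitsOf c
  refine exists_lt hU.fst (R := fun (p : E × ℕ) m =>
    ∃ Q < 2 ^ bitsOf c p.1 * 2 ^ bitsOf c p.1 + 1, (∃ i, Q = 2 ^ i) ∧ p.2 = m * Q) ?_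
  refine exists_lt (((hU.fst.fst).mul hU.fst.fst).add (.const 1))
    (R := fun (p : (E × ℕ) × ℕ) Q => (∃ i, Q = 2 ^ i) ∧ p.1.2 = p.2 * Q) ?_
  exact (isPowerOfTwo .snd).and (Feasible.snd.fst.fst.eq (Feasible.snd.fst.mul .snd))

/-- Only the comparison with multiples of the unit matters for rounding; `f` itself may be
irrational. -/
theorem FeasibleReal.rnd_of_le {c : ℕ} {f : E → ℝ}
    (hpos : Definable fun p : E × ℕ => (p.2 : ℝ) ≤ f p.1 * 2 ^ bitsOf c p.1)
    (hneg : Definable fun p : E × ℕ => (p.2 : ℝ) ≤ -f p.1 * 2 ^ bitsOf c p.1) :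
    FeasibleReal c fun e => rnd (bitsOf c e) (f e) := by
  classical
  have hU : Feasible fun e : E => 2 ^ bitsOf c e := .two_pow_bitsOf c
  have hbound := hU.mul (hU.mul hU)
  have hsign : Definable fun e => 0 ≤ f e := by
    refine (hpos.comp (DefinableMap.id.pair (.const 0))).congr fun e => ?_
    simp only [Nat.cast_zero]
    exact mul_nonneg_iff_of_pos_right (by positivity)
  have hP := hbound.findGreatest
    (R := fun e q => IsFloat (bitsOf c e) q ∧ (q : ℝ) ≤ f e * 2 ^ bitsOf c e)
    ((Definable.isFloat c).and hpos)
  have hN := hbound.findGreatest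
    (R := fun e q => IsFloat (bitsOf c e) q ∧ (q : ℝ) ≤ -f e * 2 ^ bitsOf c e)
    ((Definable.isFloat c).and hneg)
  refine ⟨_, _, .ite hsign hP (.const 0), .ite hsign (.const 0) hN, fun e => ?_⟩
  simp only [rnd]
  split_ifs with h
  · rw [sSup_floats _ h, Nat.cast_zero, sub_zero]
  · rw [sSup_floats _ (by linarith : 0 ≤ -f e), Nat.cast_zero, zero_sub, neg_div]

theorem natCast_le_sqrt_mul_iff {q : ℕ} {x u : ℝ} (hu : 0 < u) :
    (q : ℝ) ≤ √x * u ↔ q = 0 ∨ (q : ℝ) * q ≤ x * (u * u) := by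
  rcases Nat.eq_zero_or_pos q with rfl | hq
  · simp only [Nat.cast_zero, true_or, iff_true]
    positivity
  · rw [← div_le_iff₀ hu, Real.le_sqrt' (div_pos (Nat.cast_pos.2 hq) hu), div_pow,
      div_le_iff₀ (by positivity), pow_two, pow_two]
    simp only [hq.ne', false_or]

theorem natCast_le_neg_sqrt_mul_iff {q : ℕ} {x u : ℝ} (hu : 0 < u) :
    (q : ℝ) ≤ -√x * u ↔ q = 0 ∧ x ≤ 0 := by
  rw [← Real.sqrt_eq_zero', ← Nat.cast_eq_zero (R := ℝ)]
  have hq : (0 : ℝ) ≤ q := q.cast_nonneg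
  have hx := Real.sqrt_nonneg x
  constructor
  · intro h
    have := mul_nonneg hx hu.le
    exact ⟨hq.antisymm' (by linarith),
      (mul_eq_zero.1 (by linarith : √x * u = 0)).resolve_right hu.ne'⟩
  · rintro ⟨hq, hx⟩
    simp [hq, hx]

namespace FeasibleRat

variable {f : E → ℝ}

theorem rnd (hf : FeasibleRat f) (c : ℕ) : FeasibleReal c fun e => rnd (bitsOf c e) (f e) := by
  have hf' := hf.comp .fst
  have hU := (two_pow_bitsOf (E := E) c).comp .fst
  exact .rnd_of_le ((natCast .snd).le (hf'.mul hU)) ((natCast .snd).le (hf'.neg.mul hU))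

theorem rnd_sqrt (hf : FeasibleRat f) (c : ℕ) :
    FeasibleReal c fun e => _root_.rnd (bitsOf c e) √(f e) := by
  have hf' := hf.comp .fst
  have hU := (two_pow_bitsOf (E := E) c).comp .fst
  have hq : FeasibleRat fun p : E × ℕ => (p.2 : ℝ) := natCast .snd
  have hzero : FeasibleRat fun _ : E × ℕ => (0 : ℝ) := by simpa using const 0
  refine .rnd_of_le ?_ ?_
  · refine ((Feasible.snd.eq (.const 0)).or ((hq.mul hq).le (hf'.mul (hU.mul hU)))).congr
      fun p => (natCast_le_sqrt_mul_iff (by positivity)).symm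
  · exact ((Feasible.snd.eq (.const 0)).and (hf'.le hzero)).congr
      fun p => (natCast_le_neg_sqrt_mul_iff (by positivity)).symm

end FeasibleRat

theorem exists_findGreatest_eq_sup' {n : ℕ} {s : Finset (Fin (n + 1))} (hs : s.Nonempty)
    (F : Fin (n + 1) → ℝ) {M : ℕ → Prop} [DecidablePred M]
    (hM : ∀ j : Fin (n + 1), M j ↔ j ∈ s ∧ ∀ i ∈ s, F i ≤ F j) :
    ∃ j : Fin (n + 1), (j : ℕ) = Nat.findGreatest M n ∧ F j = s.sup' hs F := by
  obtain ⟨i, hi, hmax⟩ := s.exists_max_image F hs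
  have hspec := Nat.findGreatest_spec (Nat.le_of_lt_succ i.2) ((hM i).2 ⟨hi, hmax⟩)
  let j : Fin (n + 1) := ⟨Nat.findGreatest M n, Nat.lt_succ_of_le (Nat.findGreatest_le n)⟩
  obtain ⟨hj, hjmax⟩ := (hM j).1 hspec
  exact ⟨j, rfl, le_antisymm (s.le_sup' F hj) (s.sup'_le hs F hjmax)⟩

namespace FeasibleReal

variable {c : ℕ} {f g : E → ℝ}

theorem rat (hf : FeasibleReal c f) : FeasibleRat f := by
  obtain ⟨P, N, hP, hN, h⟩ := hf
  exact ⟨P, N, _, hP, hN, .two_pow_bitsOf c, fun e => by positivity, fun e => by simp [h]⟩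

theorem comp {f : E' → ℝ} (hf : FeasibleReal c f) {g : E → E'} (hg : DefinableMap g) :
    FeasibleReal c fun e => f (g e) := by
  obtain ⟨P, N, hP, hN, h⟩ := hf
  exact ⟨_, _, hP.comp hg, hN.comp hg, fun e => by
    beta_reduce; rw [h, bitsOf, bitsOf, hg.last_eq]⟩

theorem const_rnd (c : ℕ) (q : ℚ) : FeasibleReal c fun e : E => rnd (bitsOf c e) (q : ℝ) :=
  (FeasibleRat.const q).rnd c

theorem zero : FeasibleReal c fun _ : E => (0 : ℝ) :=
  ⟨_, _, .const 0, .const 0, fun _ => by simp⟩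

theorem add (hf : FeasibleReal c f) (hg : FeasibleReal c g) :
    FeasibleReal c fun e => f e + g e := by
  obtain ⟨P, N, hP, hN, h⟩ := hf
  obtain ⟨P', N', hP', hN', h'⟩ := hg
  refine ⟨_, _, hP.add hP', hN.add hN', fun e => ?_⟩
  beta_reduce
  rw [h, h', ← add_div]
  push_cast
  ring

theorem sum {ι : Type*} (s : Finset ι) {f : ι → E → ℝ} (hf : ∀ i, FeasibleReal c (f i)) :
    FeasibleReal c fun e => ∑ i ∈ s, f i e := by
  classical
  induction s using Finset.induction_on with
  | empty => simpa using zero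
  | insert i s hi ih => simpa only [Finset.sum_insert hi] using (hf i).add ih

theorem ite {R : E → Prop} [DecidablePred R] (hR : Definable R) (hf : FeasibleReal c f)
    (hg : FeasibleReal c g) : FeasibleReal c fun e => if R e then f e else g e := by
  obtain ⟨P, N, hP, hN, h⟩ := hf
  obtain ⟨P', N', hP', hN', h'⟩ := hg
  refine ⟨_, _, .ite hR hP hP', .ite hR hN hN', fun e => ?_⟩
  beta_reduce
  split_ifs
  exacts [h e, h' e]

section Positions

variable {F : Pos E → ℝ} {R : ∀ e : E, Fin (last e + 1) → Prop} [∀ e, DecidablePred (R e)]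

theorem sum_fin (hF : FeasibleReal c F) (hR : Definable fun p : Pos E => R p.1 p.2) :
    FeasibleReal c fun e => ∑ j ∈ Finset.univ.filter (R e), F ⟨e, j⟩ := by
  obtain ⟨P, N, hP, hN, h⟩ := hF
  refine ⟨_, _, hP.sum_fin hR, hN.sum_fin hR, fun e => ?_⟩
  push_cast
  rw [← Finset.sum_sub_distrib, Finset.sum_div]
  exact Finset.sum_congr rfl fun j _ => h ⟨e, j⟩

theorem sup' (hF : FeasibleReal c F) (hR : Definable fun p : Pos E => R p.1 p.2)
    (hne : ∀ e, (Finset.univ.filter (R e)).Nonempty) :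
    FeasibleReal c fun e => (Finset.univ.filter (R e)).sup' (hne e) fun j => F ⟨e, j⟩ := by
  classical
  let IsMax (e : E) (y : ℕ) : Prop := R (clamp (e, y)).1 (clamp (e, y)).2 ∧
    ∀ z < last e + 1, R (clamp (e, z)).1 (clamp (e, z)).2 → F (clamp (e, z)) ≤ F (clamp (e, y))
  have hIsMax : Definable fun p : E × ℕ => IsMax p.1 p.2 := by
    refine (hR.comp .clamp).and ?_
    refine Definable.forall_lt (R := fun (p : E × ℕ) z =>
      R (clamp (p.1, z)).1 (clamp (p.1, z)).2 → F (clamp (p.1, z)) ≤ F (clamp (p.1, p.2)))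
      (Feasible.last.fst.add (.const 1)) ?_
    have hz : DefinableMap fun p : (E × ℕ) × ℕ => clamp (p.1.1, p.2) :=
      .comp .clamp (.pair (.comp .fst .fst) .snd)
    exact (hR.comp hz).imp ((hF.comp hz).rat.le (hF.comp (.comp .clamp .fst)).rat)
  have hargmax := Feasible.last.findGreatest hIsMax
  convert hF.comp (.comp .clamp (DefinableMap.id.pair hargmax)) with e
  have hM : ∀ j : Fin (last e + 1), IsMax e j ↔ j ∈ Finset.univ.filter (R e) ∧
      ∀ i ∈ Finset.univ.filter (R e), F ⟨e, i⟩ ≤ F ⟨e, j⟩ := fun j => by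
    have hforall : ∀ {P : ℕ → Prop}, (∀ z < last e + 1, P z) ↔ ∀ i : Fin (last e + 1), P i :=
      ⟨fun h i => h i i.2, fun h z hz => h ⟨z, hz⟩⟩
    have hR_clamp : ∀ i : Fin (last e + 1), R (clamp (e, (i : ℕ))).1 (clamp (e, (i : ℕ))).2 ↔
        R e i := fun i => by rw [clamp_val]
    simp only [IsMax, hforall, hR_clamp, clamp_val, Finset.mem_filter, Finset.mem_univ, true_and]
  obtain ⟨j, hj, hFj⟩ := exists_findGreatest_eq_sup' (hne e) (fun j => F ⟨e, j⟩) hM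
  rw [← hj, clamp_val, hFj]

end Positions

theorem rnd_uniformMap {m : ℕ} (ω : UniformMap m) {g : Fin m → E → ℕ}
    (hg : ∀ i, Feasible (g i)) :
    FeasibleReal c fun e => rnd (bitsOf c e) ((ω.eval fun i => g i e : ℝ) / 2 ^ bitsOf c e) := by
  simp only [UniformMap.eval, Int.cast_sub, Int.cast_natCast]
  exact (((FeasibleRat.natCast (.of_lowerElementary ω.pos_le hg)).sub
    (.natCast (.of_lowerElementary ω.neg_le hg))).div (.two_pow_bitsOf c)).rnd c

theorem scalar (ω : UniformMap 3) (hf : FeasibleReal c f) :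
    FeasibleReal c fun e => ω.scalar (bitsOf c e) (f e) := by
  obtain ⟨P, N, hP, hN, h⟩ := hf
  have floor_eq : ∀ e, ⌊f e * 2 ^ bitsOf c e⌋ = (P e : ℤ) - N e := fun e => by
    rw [h, div_mul_cancel₀ _ (by positivity)]
    exact_mod_cast Int.floor_intCast ((P e : ℤ) - N e)
  convert rnd_uniformMap ω (g := ![fun e : E => 2 ^ bitsOf c e, fun e => P e - N e,
    fun e => N e - P e]) (Fin.forall_fin_succ.2 ⟨.two_pow_bitsOf c,
      Fin.forall_fin_two.2 ⟨hP.sub hN, hN.sub hP⟩⟩) with e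
  rw [UniformMap.scalar, floor_eq]
  congr 4
  funext i
  fin_cases i <;> simp

theorem position (ω : UniformMap 3) {i : E → ℕ} (hi : Feasible i) :
    FeasibleReal c fun e => ω.position (bitsOf c e) (last e + 1) (i e) := by
  convert rnd_uniformMap ω (g := ![fun e : E => 2 ^ bitsOf c e, fun e => last e + 1, i])
    (Fin.forall_fin_succ.2 ⟨.two_pow_bitsOf c,
      Fin.forall_fin_two.2 ⟨Feasible.last.add (.const 1), hi⟩⟩) with e
  rw [UniformMap.position]
  congr 4
  funext i
  fin_cases i <;> rfl

end FeasibleReal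

/-! ## The operations of a transformer -/

namespace FeasibleReal

variable {c : ℕ} {ι κ : Type} [Fintype ι]

theorem fdot_univ {x y : E → ι → ℝ} (hx : ∀ j, FeasibleReal c fun e => x e j)
    (hy : ∀ j, FeasibleReal c fun e => y e j) :
    FeasibleReal c fun e => fdot (bitsOf c e) Finset.univ (x e) (y e) :=
  (FeasibleReal.sum Finset.univ fun j => ((hx j).rat.mul (hy j).rat).rnd c).rat.rnd c

theorem affine (A : AffineMapQ ι κ) {x : E → ι → ℝ} (hx : ∀ j, FeasibleReal c fun e => x e j)
    (k : κ) : FeasibleReal c fun e => A.apply (bitsOf c e) (x e) k :=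
  ((fdot_univ (fun j => const_rnd c (A.weight k j)) hx).rat.add
    (const_rnd c (A.bias k)).rat).rnd c

variable {d : ℕ}

theorem layerNorm (N : LayerNorm d) {x : E → Fin d → ℝ}
    (hx : ∀ j, FeasibleReal c fun e => x e j) (k : Fin d) :
    FeasibleReal c fun e => N.apply (bitsOf c e) (x e) k := by
  have hd : FeasibleRat fun _ : E => (d : ℝ) := .natCast (.const d)
  have hmean := (((FeasibleReal.sum Finset.univ hx).rat.rnd c).rat.div hd).rnd c
  have hy := fun k => ((hx k).rat.sub hmean.rat).rnd c
  have hvar := ((fdot_univ hy hy).rat.div hd).rnd c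
  have hsd := ((hvar.rat.add (const_rnd c N.eps).rat).rnd c).rat.rnd_sqrt c
  exact ((((const_rnd c (N.gain k)).rat.mul (((hy k).rat.div hsd.rat).rnd c).rat).rnd c).rat.add
    (const_rnd c (N.shift k)).rat).rnd c

theorem applyNorm (N : Option (LayerNorm d)) {x : E → Fin d → ℝ}
    (hx : ∀ j, FeasibleReal c fun e => x e j) (k : Fin d) :
    FeasibleReal c fun e => applyNorm N (bitsOf c e) (x e) k := by
  cases N with
  | none => exact hx k
  | some N => exact layerNorm N hx k

end FeasibleReal

theorem DefinableMap.pos_swap : DefinableMap fun e : Pos (Pos E) => (⟨e.1.1, e.2⟩ : Pos E) :=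
  .pos (.comp .pos_fst .pos_fst) .snd

theorem Definable.visible (causal : Bool) :
    Definable fun e : Pos (Pos E) => causal = true → e.2 ≤ e.1.2 :=
  (Definable.const (causal = true)).imp
    (IsPosition.snd.isTerm.le (IsPosition.snd.comp .pos_fst).isTerm)

namespace FeasibleReal

variable {c d : ℕ} {X : (e : E) → Fin (last e + 1) → Fin d → ℝ}

theorem score (H : Head d m) (hX : ∀ k, FeasibleReal c fun e : Pos E => X e.1 e.2 k) :
    FeasibleReal c fun e : Pos (Pos E) => H.score (bitsOf c e) (X e.1.1) e.1.2 e.2 := by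
  have hquery := affine H.query fun k => (hX k).comp (.pos_fst (E := Pos E))
  have hkey := affine H.key fun k => (hX k).comp .pos_swap
  have hm : FeasibleRat fun _ : Pos (Pos E) => (m : ℝ) := .natCast (.const m)
  exact ((fdot_univ hquery hkey).rat.div (hm.rnd_sqrt c).rat).rnd c

theorem rawWeight (H : Head d m) (ω : UniformMap 3)
    (hX : ∀ k, FeasibleReal c fun e : Pos E => X e.1 e.2 k) :
    FeasibleReal c fun e : Pos (Pos E) => H.rawWeight ω (bitsOf c e) (X e.1.1) e.1.2 e.2 := by
  have hscore := score H hX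
  have hmax := hscore.sup' (.visible H.causal) fun e => H.visible_nonempty e.2
  exact ((hscore.rat.sub (hmax.comp .pos_fst).rat).rnd c).scalar ω

theorem output (H : Head d m) (ω : UniformMap 3)
    (hX : ∀ k, FeasibleReal c fun e : Pos E => X e.1 e.2 k) (k : Fin m) :
    FeasibleReal c fun e : Pos E => H.output ω (bitsOf c e) (X e.1) e.2 k := by
  have hweight := rawWeight H ω hX
  have hvisible := Definable.visible (E := E) H.causal
  have htotal := (hweight.sum_fin (R := fun e j => H.causal = true → j ≤ e.2) hvisible).rat.rnd c
  have hvalue := (affine H.value (x := fun e : Pos E => X e.1 e.2) hX k).comp .pos_swap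
  have hterm := (((hweight.rat.div (htotal.comp .pos_fst).rat).rnd c).rat.mul hvalue.rat).rnd c
  exact (hterm.sum_fin (R := fun e j => H.causal = true → j ≤ e.2) hvisible).rat.rnd c

theorem rnd_token [Finite α] (c : ℕ) (q : α → ℚ) : FeasibleReal c fun e : Pos E =>
    rnd (bitsOf c e) (q ((str e.1).1.2 e.2)) := by
  classical
  have := Fintype.ofFinite α
  convert FeasibleReal.sum (c := c) Finset.univ fun a : α =>
    .ite (Definable.token (E := E) a) (.const_rnd c (q a)) .zero with e
  simp only [Finset.sum_ite_eq, Finset.mem_univ, if_true]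

theorem block (B : Block d) (ω σ : UniformMap 3)
    (hX : ∀ k, FeasibleReal c fun e : Pos E => X e.1 e.2 k) (k : Fin d) :
    FeasibleReal c fun e : Pos E => B.apply ω σ (bitsOf c e) (X e.1) e.2 k := by
  have hcombine := affine B.combine
    (x := fun (e : Pos E) hk => (B.heads hk.1).output ω (bitsOf c e)
      (fun i => _root_.applyNorm B.preAttention (bitsOf c e) (X e.1 i)) e.2 hk.2)
    (fun hk => output (X := fun e i => _root_.applyNorm B.preAttention (bitsOf c e) (X e i))
      (B.heads hk.1) ω (applyNorm B.preAttention hX) hk.2)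
  have hz := applyNorm B.postAttention fun k => ((hX k).rat.add (hcombine k).rat).rnd c
  have hinner := affine B.inner (applyNorm B.preFeedForward hz)
  have houter := affine B.outer fun l => (hinner l).scalar σ
  exact applyNorm B.postFeedForward (fun k => ((hz k).rat.add (houter k).rat).rnd c) k

end FeasibleReal

/-! ## Sentences -/

/-- A property of strings of any length that is defined by a single sentence. -/
def Axiomatizable (P : Str α → Prop) : Prop :=
  ∃ φ : Sentence α, ∀ w, φ.Sat w Fin.elim0 ↔ P w

namespace Axiomatizable

variable {P Q : Str α → Prop}

theorem congr (hP : Axiomatizable P) (h : ∀ w, P w ↔ Q w) : Axiomatizable Q :=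
  funext (propext <| h ·) ▸ hP

theorem not (hP : Axiomatizable P) : Axiomatizable fun w => ¬ P w :=
  let ⟨φ, hφ⟩ := hP
  ⟨.not φ, fun w => not_congr (hφ w)⟩

theorem and (hP : Axiomatizable P) (hQ : Axiomatizable Q) : Axiomatizable fun w => P w ∧ Q w :=
  let ⟨φ, hφ⟩ := hP
  let ⟨ψ, hψ⟩ := hQ
  ⟨.and φ ψ, fun w => and_congr (hφ w) (hψ w)⟩

theorem or (hP : Axiomatizable P) (hQ : Axiomatizable Q) : Axiomatizable fun w => P w ∨ Q w :=
  let ⟨φ, hφ⟩ := hP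
  let ⟨ψ, hψ⟩ := hQ
  ⟨.or φ ψ, fun w => or_congr (hφ w) (hψ w)⟩

theorem true : Axiomatizable fun _ : Str α => True :=
  ⟨.eq .one .one, fun _ => iff_true_intro rfl⟩

theorem forall_mem {ι : Type*} {s : Set ι} (hs : s.Finite) {P : ι → Str α → Prop}
    (hP : ∀ i, Axiomatizable (P i)) : Axiomatizable fun w => ∀ i ∈ s, P i w := by
  induction s, hs using Set.Finite.induction_on with
  | empty => exact true.congr fun w => by simp
  | @insert i s _ _ ih => exact ((hP i).and ih).congr fun w => by simp

end Axiomatizable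

theorem Term.exists_eval_eq (c : ℕ) : ∃ t : Term 0, ∀ n v, t.eval n v = c := by
  induction c with
  | zero => exact ⟨.sub .one .one, fun n v => by simp [Term.eval]⟩
  | succ c ih =>
    obtain ⟨t, ht⟩ := ih
    exact ⟨.add t .one, fun n v => by simp [Term.eval, ht]⟩

namespace Axiomatizable

theorem length_eq (n : ℕ) : Axiomatizable fun w : Str α => w.1 = n := by
  obtain ⟨t, ht⟩ := Term.exists_eval_eq (n + 1)
  refine ⟨.eq .len t, fun w => ?_⟩
  simp only [Formula.Sat, Term.eval, ht]
  omega

theorem token (p : ℕ) (a : α) :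
    Axiomatizable fun w : Str α => ∃ q : Fin (w.1 + 1), (q : ℕ) = p ∧ w.2 q = a := by
  obtain ⟨t, ht⟩ := Term.exists_eval_eq (p + 1)
  refine ⟨.token a t, fun w => ?_⟩
  simp only [Formula.Sat, ht]
  exact exists_congr fun q => and_congr_left' (by omega)

theorem singleton (w₀ : Str α) : Axiomatizable fun w => w = w₀ := by
  have htokens := forall_mem Set.finite_univ fun p : Fin (w₀.1 + 1) => token p (w₀.2 p)
  refine ((length_eq w₀.1).and htokens).congr fun w => ?_
  constructor
  · rintro ⟨hlen, h⟩
    obtain ⟨n, a⟩ := w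
    obtain ⟨n', a'⟩ := w₀
    obtain rfl : n = n' := hlen
    congr 1
    funext p
    obtain ⟨q, hq, hq'⟩ := h p (Set.mem_univ _)
    exact (congrArg a (Fin.ext hq)).symm.trans hq'
  · rintro rfl
    exact ⟨rfl, fun p _ => ⟨p, rfl, rfl⟩⟩

theorem of_finite {S : Set (Str α)} (hS : S.Finite) : Axiomatizable fun w => w ∈ S :=
  (forall_mem hS fun w₀ => (singleton w₀).not).not.congr fun w => by simp

end Axiomatizable

theorem finite_setOf_length_lt [Finite α] (N : ℕ) : {w : Str α | w.1 < N}.Finite := by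
  refine (Set.finite_range fun x : (n : Fin N) × (Fin ((n : ℕ) + 1) → α) =>
    (⟨x.1, x.2⟩ : Str α)).subset ?_
  rintro ⟨n, a⟩ h
  exact ⟨⟨⟨n, h⟩, a⟩, rfl⟩

theorem Axiomatizable.of_definable [Finite α] {P : Str α → Prop}
    (hP : Definable fun w : LongStr α => P w.1) : Axiomatizable P := by
  obtain ⟨φ, hφ⟩ := hP.of_adm (γ := fun e : Assignment α 0 => e.str) fun _ => rfl
  have hlong : ∀ w : Str α, 7 ≤ w.1 → (φ.Sat w Fin.elim0 ↔ P w) := fun w hw => by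
    simpa only [Subsingleton.elim (Assignment.vals _) Fin.elim0] using hφ ⟨⟨w, hw⟩, Fin.elim0⟩
  have hlt := finite_setOf_length_lt (α := α) 7
  have hφ' : Axiomatizable fun w : Str α => φ.Sat w Fin.elim0 := ⟨φ, fun _ => Iff.rfl⟩
  refine (((of_finite hlt).not.and hφ').or
    (of_finite (hlt.subset (Set.inter_subset_left (t := {w | P w}))))).congr fun w => ?_
  simp only [Set.mem_inter_iff, Set.mem_ofPred_eq, not_lt]
  have := hlong w
  have := le_or_gt 7 w.1
  grind

theorem models_classifierSystem_singleton (φ : Sentence α) :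
    (system α).classifierSystem.models {(⟨φ⟩ : LogicalSystem.AlphaIff (Sentence α))} =
      {M : Str α × Bool | M.2 = true ↔ φ.Sat M.1 Fin.elim0} := by
  ext M
  have truth_iff : (system α).truth M.1 {φ} ↔ φ.Sat M.1 Fin.elim0 := forall_eq
  exact forall_eq.trans (iff_congr Iff.rfl truth_iff)

end FOM

/-! ## The dynamics -/

namespace CandidateNetwork

variable {N : CandidateNetwork.{u}}

theorem Xinf_eq_fixedPoints (h : ∀ x, ∃ y, ∀ᶠ t in atTop, N.update^[t] x = y) :
    N.Xinf = Function.fixedPoints N.update := by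
  ext x
  constructor
  · rintro ⟨x₀, t, ht, hx⟩
    obtain ⟨y, hy⟩ := h x₀
    obtain rfl : y = x := tendsto_nhds_unique
      (tendsto_const_nhds.congr' (ht.tendsto_atTop.eventually (hy.mono fun _ => Eq.symm))) hx
    obtain ⟨s, hs, hs'⟩ := (hy.and ((tendsto_add_atTop_nat 1).eventually hy)).exists
    rwa [Function.iterate_succ_apply', hs] at hs'
  · intro hx
    refine ⟨x, id, strictMono_id, tendsto_const_nhds.congr fun t => ?_⟩
    exact ((Function.mem_fixedPoints.1 hx).iterate t).symm

theorem isStable_of_eventually_eq (h : ∀ x, ∃ y, ∀ᶠ t in atTop, N.update^[t] x = y) :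
    N.IsStable := by
  intro x
  obtain ⟨y, hy⟩ := h x
  have hmem : y ∈ N.Xinf :=
    ⟨x, id, strictMono_id, tendsto_const_nhds.congr' (hy.mono fun _ => Eq.symm)⟩
  refine tendsto_const_nhds.congr' (hy.mono fun t ht => ?_)
  beta_reduce
  rw [ht, Metric.infDist_zero_of_mem hmem]

theorem isSemanticEncoding_of_represented_eq {S : LogicalSystem.{u}} {i : N.EncodingFunction S}
    {Agg : Set (Set S.Interp) → Set S.Interp} {L : Set S.Sentence}
    (hne : (represented i Agg).Nonempty) (h : represented i Agg = S.models L) :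
    IsSemanticEncoding i Agg L :=
  ⟨⟨hne, h.subset⟩, fun _ => h ▸ Iff.rfl⟩

end CandidateNetwork

namespace Transformer

open FOM

variable {α : Type u} (T : Transformer α)

/-- The activations of all layers in a feed-forward evaluation of the transformer. -/
noncomputable def hiddenActivation (w : Str α) : T.Hidden w.1 :=
  Fin.induction (T.embed w.2) fun l h =>
    (T.blocks l).apply T.attentionWeight T.activation (T.bits (w.1 + 1)) h

/-- The output label of a feed-forward evaluation of the transformer. -/
noncomputable def label (w : Str α) : Bool := T.classify (T.hiddenActivation w (Fin.last T.depth))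

theorem feasibleReal_embed [Finite α] (k : Fin T.dim) :
    FeasibleReal T.precision fun e : Pos (LongStr α) => T.embed e.1.1.2 e.2 k := by
  have htoken := FeasibleReal.rnd_token (E := LongStr α) T.precision (T.tokenEmbedding · k)
  exact (htoken.rat.add (FeasibleReal.position (T.positionEmbedding k)
    (IsPosition.snd.feasible.add (.const 1))).rat).rnd _

theorem feasibleReal_hiddenActivation [Finite α] (l : Fin (T.depth + 1)) :
    ∀ k, FeasibleReal T.precision fun e : Pos (LongStr α) =>
      T.hiddenActivation e.1.1 l e.2 k := by
  induction l using Fin.induction with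
  | zero => exact T.feasibleReal_embed
  | succ l ih =>
    exact FeasibleReal.block (X := fun (w : LongStr α) i => T.hiddenActivation w.1 l.castSucc i)
      (T.blocks l) T.attentionWeight T.activation ih

theorem definable_label [Finite α] : Definable fun w : LongStr α => T.label w.1 = true := by
  have hlast : DefinableMap fun w : LongStr α => (⟨w, Fin.last _⟩ : Pos (LongStr α)) :=
    DefinableMap.id.pos (Feasible.last.isPosition fun _ => le_rfl)
  have hout := FeasibleReal.affine T.classifier (FeasibleReal.applyNorm T.finalNorm fun k =>
    (T.feasibleReal_hiddenActivation (Fin.last T.depth) k).comp hlast) ()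
  refine ((FeasibleReal.zero (c := T.precision)).rat.lt hout.rat).congr fun w => ?_
  simp only [label, classify, decide_eq_true_eq]
  rfl

/-- The state in which all neurons have the values of a feed-forward evaluation on `w`. -/
noncomputable def fixedState (w : Str α) : T.State :=
  ⟨w.1, w.2, T.label w, T.hiddenActivation w⟩

theorem hiddenActivation_zero (w : Str α) : T.hiddenActivation w 0 = T.embed w.2 :=
  Fin.induction_zero _ _

theorem hiddenActivation_succ (w : Str α) (l : Fin T.depth) :
    T.hiddenActivation w l.succ = (T.blocks l).apply T.attentionWeight T.activation
      (T.bits (w.1 + 1)) (T.hiddenActivation w l.castSucc) :=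
  Fin.induction_succ _ _ l

theorem iterate_step (n : ℕ) (w : Fin (n + 1) → α) (b : Bool) (h : T.Hidden n) (t : ℕ) :
    ∃ b' h', T.step^[t] ⟨n, w, b, h⟩ = ⟨n, w, b', h'⟩ ∧
      (∀ l : Fin (T.depth + 1), (l : ℕ) < t → h' l = T.hiddenActivation ⟨n, w⟩ l) ∧
      (T.depth + 1 < t → b' = T.label ⟨n, w⟩) := by
  induction t with
  | zero => exact ⟨b, h, rfl, fun l hl => absurd hl (Nat.not_lt_zero _), fun h => by omega⟩
  | succ t ih =>
    obtain ⟨b', h', ht, hl, -⟩ := ih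
    rw [Function.iterate_succ_apply', ht]
    refine ⟨_, _, rfl, fun l => ?_, fun hlt => ?_⟩
    · cases l using Fin.cases with
      | zero => exact fun _ => (T.hiddenActivation_zero ⟨n, w⟩).symm
      | succ l =>
        intro hlt
        rw [Fin.cases_succ, hiddenActivation_succ, hl l.castSucc (by simpa using hlt)]
    · rw [hl (Fin.last T.depth) (by rw [Fin.val_last]; omega), label]

theorem iterate_step_eq_fixedState (x : T.State) {t : ℕ} (ht : T.depth + 1 < t) :
    T.step^[t] x = T.fixedState ⟨x.1, x.2.1⟩ := by
  obtain ⟨n, w, b, h⟩ := x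
  obtain ⟨b', h', hstep, hl, hb⟩ := T.iterate_step n w b h t
  rw [hstep, hb ht, show h' = T.hiddenActivation ⟨n, w⟩ from funext fun l => hl l (by omega)]
  rfl

theorem eventually_iterate_update_eq (x : T.network.State) :
    ∃ y, ∀ᶠ t in atTop, T.network.update^[t] x = y :=
  ⟨T.fixedState (T.network.vis x).1, (eventually_gt_atTop (T.depth + 1)).mono fun _ =>
    T.iterate_step_eq_fixedState x⟩

theorem isStable_network : T.network.IsStable :=
  CandidateNetwork.isStable_of_eventually_eq T.eventually_iterate_update_eq

theorem Xinf_network : T.network.Xinf = Set.range T.fixedState := by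
  rw [CandidateNetwork.Xinf_eq_fixedPoints T.eventually_iterate_update_eq]
  ext x
  constructor
  · intro hx
    have hiter := (Function.mem_fixedPoints.1 hx).iterate (T.depth + 2)
    exact ⟨_, (T.iterate_step_eq_fixedState x (Nat.lt_succ_self _)).symm.trans hiter⟩
  · rintro ⟨w, rfl⟩
    have hiter := T.iterate_step_eq_fixedState (T.fixedState w) (Nat.lt_succ_self _)
    have hiter' := T.iterate_step_eq_fixedState (T.fixedState w)
      (Nat.lt_succ_of_lt (Nat.lt_succ_self _))
    rw [Function.iterate_succ_apply', hiter] at hiter'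
    exact hiter'

theorem represented_encoding : CandidateNetwork.represented T.encoding Set.sUnion =
    {M : Str α × Bool | M.2 = T.label M.1} := by
  rw [CandidateNetwork.represented, Xinf_network]
  ext ⟨w, b⟩
  constructor
  · rintro ⟨_, ⟨_, ⟨w', rfl⟩, rfl⟩, h⟩
    obtain ⟨rfl, rfl⟩ := Prod.mk.inj (Set.mem_singleton_iff.1 h)
    rfl
  · intro h
    obtain rfl : b = T.label w := h
    exact ⟨_, ⟨_, ⟨w, rfl⟩, rfl⟩, rfl⟩

end Transformer

theorem mainTheorem10 {α : Type u} [Finite α] [Nonempty α] (T : Transformer α) :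
    T.network.IsStable ∧
      ∃ φ : FOM.Sentence α,
        CandidateNetwork.IsSemanticEncoding T.encoding Set.sUnion
          {(⟨φ⟩ : LogicalSystem.AlphaIff (FOM.Sentence α))} := by
  obtain ⟨φ, hφ⟩ := FOM.Axiomatizable.of_definable (P := fun w => T.label w = true)
    T.definable_label
  refine ⟨T.isStable_network, φ, CandidateNetwork.isSemanticEncoding_of_represented_eq ?_ ?_⟩
  · obtain ⟨a⟩ := ‹Nonempty α›
    rw [T.represented_encoding]
    exact ⟨(⟨0, fun _ => a⟩, T.label ⟨0, fun _ => a⟩), rfl⟩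
  · rw [T.represented_encoding, FOM.models_classifierSystem_singleton]
    ext M
    exact Bool.eq_iff_iff.trans (iff_congr Iff.rfl (hφ M.1).symm)
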